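/- Let $\mathbb K$ be an infinite field, $n,r$ positive integers, $B^+\subset GL_n(\mathbb K)$ the subgroup of upper triangular matrices, and let the Borel--Schur algebra $S=S(B^+,n,r)$ be the image of the group algebra $\mathbb K B^+$ in $\mathrm{End}_{\mathbb K}((\mathbb K^n)^{\otimes r})$. For multi-indices $i\le j$ (componentwise) in $\{1,\dots,n\}^r$ let $\xi_{i,j}\in S$ be the endomorphism whose matrix in the standard basis of $(\mathbb K^n)^{\otimes r}$ has entry $1$ at the positions $(i\pi,j\pi)$, $\pi\in\Sigma_r$, and $0$ elsewhere. For a composition $\lambda=(\lambda_1,\dots,\lambda_n)$ of $r$ (with $\lambda_k\ge 0$) put $l(\lambda)=(1^{\lambda_1},2^{\lambda_2},\dots,n^{\lambda_n})$ and $\xi_\lambda=\xi_{l(\lambda),l(\lambda)}$, and let $\mathbb K_\lambda$ be the one-dimensional $S$-module on which $\xi_\lambda$ acts as the identity and all other basis elements $\xi_{i,j}$ of $S$ act as $0$. For $1\le\nu\le n-1$ and $0\le m\le\lambda_{\nu+1}$ let $\lambda(\nu,m)=(\dots,\lambda_\nu+m,\lambda_{\nu+1}-m,\dots)$. Put $P_0=S\xi_\lambda$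 and $$P_1=\bigoplus_{(\nu,m)}S\xi_{\lambda(\nu,m)},$$ the sum over all $1\le\nu\le n-1$ and all $m\le\lambda_{\nu+1}$ with $m=1$ if $\mathrm{char}\,\mathbb K=0$, and with $m\in\{1,p,p^2,\dots\}$ if $\mathrm{char}\,\mathbb K=p>0$. Let $p_1\colon P_1\to P_0$ be the $S$-homomorphism with $\xi_{\lambda(\nu,m)}\mapsto\xi_{l(\lambda(\nu,m)),\,l(\lambda)}$. Write $X^t=\mathrm{Hom}_S(X,S)$ and $D=\mathrm{Hom}_{\mathbb K}(-,\mathbb K)$, let $\theta\colon\mathbb K_\lambda\to DP_0^t$ be given by $\theta(c)(\varphi)=\varphi(\xi_\lambda)\,c$, and set $$\tau\mathbb K_\lambda=\ker(Dp_1^t),\qquad E(\lambda)=\{(z,c)\in DP_1^t\oplus\mathbb K_\lambda \mid Dp_1^t(z)=\theta(c)\}.$$ (1) If the module $P_1$ is indecomposable, then the sequence $0\to\tau\mathbb K_\lambda\to E(\lambda)\to\mathbb K_\lambda\to0$ with maps $z\mapsto(z,0)$ and $(z,c)\mapsto c$ is an Auslander--Reiten sequence of finite-dimensional $S$-modules,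 and its middle term $E(\lambda)$ has simple socle and is indecomposable. (2) If $n=2$, $\mathrm{char}\,\mathbb K=0$ and $\lambda_2\ne0$ (that is, $\mathbb K_\lambda$ is not projective), then this sequence is an Auslander--Reiten sequence and its middle term $E(\lambda)$ is indecomposable. -/

import Mathlib

open scoped TensorProduct

universe u

/-! ## Modules over a ring: socles, indecomposability, Auslander–Reiten sequences -/

/-- A module is indecomposable if it is nonzero and is not the internal direct sum of two
nonzero submodules. -/
def IsIndecomposable (A : Type*) [Ring A] (M : Type*) [AddCommGroup M] [Module A M] : Prop :=
  Nontrivial M ∧ ∀ p q : Submodule A M, IsCompl p q → p = ⊥ ∨ q = ⊥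

/-- The socle of a module: the sum of all its simple submodules. -/
def moduleSocle (A : Type*) [Ring A] (M : Type*) [AddCommGroup M] [Module A M] :
    Submodule A M :=
  sSup {m : Submodule A M | IsSimpleModule A m}

/-- `0 → N → E → S → 0` (with maps `f`, `g`) is an Auslander–Reiten sequence in the category of
finitely generated left `A`-modules. (For `A` a finite-dimensional algebra over a field, these
are the finite-dimensional modules.) -/
structure IsAuslanderReiten {A : Type u} [Ring A] {N E S : Type u}
    [AddCommGroup N] [Module A N] [AddCommGroup E] [Module A E] [AddCommGroup S] [Module A S]
    (f : N →ₗ[A] E) (g : E →ₗ[A] S) : Prop where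
  finite_left : Module.Finite A N
  finite_middle : Module.Finite A E
  finite_right : Module.Finite A S
  injective : Function.Injective f
  exact : Function.Exact f g
  surjective : Function.Surjective g
  not_split : ¬ ∃ s : S →ₗ[A] E, g ∘ₗ s = LinearMap.id
  indecomposable_left : IsIndecomposable A N
  indecomposable_right : IsIndecomposable A S
  factors : ∀ (X : Type u) [AddCommGroup X] [Module A X], Module.Finite A X →
    IsIndecomposable A X → ∀ h : X →ₗ[A] S, ¬ Function.Bijective h →
      ∃ h' : X →ₗ[A] E, g ∘ₗ h' = h

/-! ## The Nakayama functor -/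

section Nakayama

variable (K : Type*) [Field K] (A : Type*) [Ring A] [Algebra K A]

/-- The value at a left `A`-module `P` of the Nakayama functor: the `K`-dual of the right
`A`-module `Hom_A(P, A)`. -/
def Nakayama (P : Type*) [AddCommGroup P] [Module A P] : Type _ :=
  (P →ₗ[A] A) →ₗ[K] K

instance (P : Type*) [AddCommGroup P] [Module A P] : AddCommGroup (Nakayama K A P) :=
  inferInstanceAs (AddCommGroup ((P →ₗ[A] A) →ₗ[K] K))

/-- Right multiplication by `a` on `Hom_A(P, A)`: `(φ · a) x = φ x * a`. -/
def homMulRight (P : Type*) [AddCommGroup P] [Module A P] (a : A) :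
    (P →ₗ[A] A) →ₗ[K] (P →ₗ[A] A) where
  toFun φ :=
    { toFun := fun x => φ x * a
      map_add' := fun x y => by simp [add_mul]
      map_smul' := fun c x => by simp [mul_assoc] }
  map_add' φ ψ := by ext x; simp [add_mul]
  map_smul' c φ := by ext x; simp

/-- The left action of `A` on the Nakayama module: `(a • ψ) φ = ψ (φ · a)`. -/
instance (P : Type*) [AddCommGroup P] [Module A P] : Module A (Nakayama K A P) where
  smul a ψ := LinearMap.comp (show (P →ₗ[A] A) →ₗ[K] K from ψ) (homMulRight K A P a)
  one_smul ψ := by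
    refine LinearMap.ext fun φ => congrArg (show (P →ₗ[A] A) →ₗ[K] K from ψ) ?_
    ext x; exact mul_one _
  mul_smul a b ψ := by
    refine LinearMap.ext fun φ => congrArg (show (P →ₗ[A] A) →ₗ[K] K from ψ) ?_
    ext x; exact (mul_assoc _ _ _).symm
  smul_zero a := rfl
  smul_add a ψ ψ' := rfl
  add_smul a b ψ := by
    refine LinearMap.ext fun φ => ?_
    refine Eq.trans (congrArg (show (P →ₗ[A] A) →ₗ[K] K from ψ)
      (?_ : _ = homMulRight K A P a φ + homMulRight K A P b φ)) (map_add _ _ _)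
    ext x; exact mul_add _ _ _
  zero_smul ψ := by
    refine LinearMap.ext fun φ => ?_
    refine Eq.trans (congrArg (show (P →ₗ[A] A) →ₗ[K] K from ψ) (?_ : homMulRight K A P 0 φ = 0))
      (map_zero _)
    ext x; exact mul_zero _

/-- The Nakayama functor on morphisms: `f ↦ (ψ ↦ (φ ↦ ψ (φ ∘ f)))`. -/
def Nakayama.map {P Q : Type*} [AddCommGroup P] [Module A P] [AddCommGroup Q] [Module A Q]
    (f : P →ₗ[A] Q) : Nakayama K A P →ₗ[A] Nakayama K A Q where
  toFun ψ := LinearMap.comp (show (P →ₗ[A] A) →ₗ[K] K from ψ) (LinearMap.lcomp K A f)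
  map_add' _ _ := rfl
  map_smul' _ _ := rfl

end Nakayama

namespace BorelSchur

/-! ## The Borel–Schur algebra -/

section Algebra

variable (K : Type u) [Field K] (n r : ℕ)

/-- The tensor space `(Kⁿ)^{⊗ r}`. -/
abbrev TensorSpace : Type u := ⨂[K] _ : Fin r, (Fin n → K)

/-- The Borel subgroup of upper triangular matrices in `GL_n(K)`. -/
def borel : Subgroup (GL (Fin n) K) where
  carrier := {g | ∀ i j : Fin n, j < i → (g : Matrix (Fin n) (Fin n) K) i j = 0}
  one_mem' i j h := by simp [h.ne']
  mul_mem' {g h} hg hh i j hij := by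
    have hg' : Matrix.BlockTriangular (g : Matrix (Fin n) (Fin n) K) id := fun i j h => hg i j h
    have hh' : Matrix.BlockTriangular (h : Matrix (Fin n) (Fin n) K) id := fun i j h => hh i j h
    exact (hg'.mul hh') hij
  inv_mem' {g} hg i j hij := by
    have hg' : Matrix.BlockTriangular (g : Matrix (Fin n) (Fin n) K) id := fun i j h => hg i j h
    have : Invertible (g : Matrix (Fin n) (Fin n) K) := g.invertible
    have := Matrix.blockTriangular_inv_of_blockTriangular hg'
    rw [Matrix.coe_units_inv]
    exact this hij

/-- The standard basis `e_i = e_{i₁} ⊗ ⋯ ⊗ e_{i_r}` of tensor space, indexed by the multi-indices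
`i ∈ I(n, r)`. -/
noncomputable def tensorBasis : Module.Basis (Fin r → Fin n) K (TensorSpace K n r) :=
  Basis.piTensorProduct fun _ => Pi.basisFun K (Fin n)

/-- The algebra of endomorphisms of tensor space, written as matrices in the standard basis. -/
abbrev TensorEnd : Type u := Matrix (Fin r → Fin n) (Fin r → Fin n) K

/-- The action `g (v₁ ⊗ ⋯ ⊗ v_r) = g v₁ ⊗ ⋯ ⊗ g v_r` of the Borel subgroup on tensor space;
endomorphisms of tensor space are identified with their matrices in the standard basis. -/
noncomputable def borelAction : borel K n →* TensorEnd K n r where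
  toFun g := LinearMap.toMatrixAlgEquiv (tensorBasis K n r) (PiTensorProduct.map fun _ =>
    Matrix.toLin' ((g : GL (Fin n) K) : Matrix (Fin n) (Fin n) K))
  map_one' := by
    simp only [OneMemClass.coe_one, Units.val_one, Matrix.toLin'_one]
    rw [← map_one (LinearMap.toMatrixAlgEquiv (tensorBasis K n r))]
    exact congrArg _ PiTensorProduct.map_one
  map_mul' g h := by
    simp only [Subgroup.coe_mul, Units.val_mul, Matrix.toLin'_mul]
    rw [← map_mul (LinearMap.toMatrixAlgEquiv (tensorBasis K n r))]
    exact congrArg _ (PiTensorProduct.map_comp _ _)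

/-- The Borel–Schur algebra `S(B⁺, n, r)`: the image of the group algebra of the Borel subgroup
in the endomorphism algebra of tensor space. -/
noncomputable def borelSchur : Subalgebra K (TensorEnd K n r) :=
  (MonoidAlgebra.lift K (TensorEnd K n r) (borel K n) (borelAction K n r)).range

/-- The Borel–Schur algebra, as a type. -/
def Alg : Type u := borelSchur K n r

noncomputable instance : Ring (Alg K n r) := inferInstanceAs (Ring (borelSchur K n r))

noncomputable instance : Algebra K (Alg K n r) := inferInstanceAs (Algebra K (borelSchur K n r))

/-- The inclusion of the Borel–Schur algebra into the endomorphism algebra of tensor space. -/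
noncomputable def Alg.val : Alg K n r →ₐ[K] TensorEnd K n r := (borelSchur K n r).val

theorem Alg.val_injective : Function.Injective (Alg.val K n r) := Subtype.val_injective

theorem Alg.val_mem (a : Alg K n r) : Alg.val K n r a ∈ borelSchur K n r := Subtype.property a

variable {n r}

/-- `(i, j) ∼ (p, q)`: the pairs of multi-indices are in the same orbit of the symmetric group. -/
def SameOrbit (i j p q : Fin r → Fin n) : Prop :=
  ∃ π : Equiv.Perm (Fin r), p = i ∘ π ∧ q = j ∘ π

open Classical in
/-- The basis element `ξ_{i,j}` of the Schur algebra: its matrix in the standard basis of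
tensor space has `1` at the positions `(p, q) ∼ (i, j)` and `0` elsewhere. -/
noncomputable def xiEnd (i j : Fin r → Fin n) : TensorEnd K n r :=
  Matrix.of fun p q => if SameOrbit i j p q then 1 else 0

variable {K}

theorem borelAction_apply (g : borel K n) (p q : Fin r → Fin n) :
    borelAction K n r g p q =
      ∏ s, ((g : GL (Fin n) K) : Matrix (Fin n) (Fin n) K) (p s) (q s) := by
  simp [LinearMap.toMatrixAlgEquiv_apply, tensorBasis, borelAction, PiTensorProduct.map_tprod]

theorem apply_eq_zero_of_mem {a : TensorEnd K n r} (ha : a ∈ borelSchur K n r)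
    {p q : Fin r → Fin n} (h : ¬ p ≤ q) : a p q = 0 := by
  obtain ⟨x, rfl⟩ := ha
  obtain ⟨s, hs⟩ : ∃ s, q s < p s := by simpa [Pi.le_def] using h
  induction x using MonoidAlgebra.induction_on with
  | of g =>
    have := borelAction_apply (r := r) g p q
    rw [Finset.prod_eq_zero (Finset.mem_univ s) (g.2 _ _ hs)] at this
    simpa using this
  | add x y hx hy =>
    simp only [AlgHom.toRingHom_eq_coe, RingHom.coe_coe, map_add, Matrix.add_apply] at hx hy ⊢
    rw [hx, hy, add_zero]
  | smul c x hx =>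
    simp only [AlgHom.toRingHom_eq_coe, RingHom.coe_coe, map_smul, Matrix.smul_apply] at hx ⊢
    rw [hx, smul_zero]

theorem sameOrbit_of_forall_card {i j p q : Fin r → Fin n}
    (h : (∑ s, Finsupp.single (p s, q s) 1 : Fin n × Fin n →₀ ℕ) =
      ∑ s, Finsupp.single (i s, j s) 1) : SameOrbit i j p q := by
  classical
  have key : ∀ c : Fin n × Fin n,
      Fintype.card {s // (p s, q s) = c} = Fintype.card {s // (i s, j s) = c} := by
    intro c
    have := DFunLike.congr_fun h c
    simpa [Finsupp.finsetSum_apply, Finsupp.single_apply, Fintype.card_subtype] using this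
  let e' : ∀ c : Fin n × Fin n, {s // (p s, q s) = c} ≃ {s // (i s, j s) = c} :=
    fun c => Fintype.equivOfCardEq (key c)
  let e := Equiv.ofFiberEquiv (f := fun s => (p s, q s)) (g := fun s => (i s, j s)) e'
  have he : ∀ s, (i (e s), j (e s)) = (p s, q s) := fun s => Equiv.ofFiberEquiv_map e' s
  exact ⟨e, funext fun s => (congrArg Prod.fst (he s)).symm,
    funext fun s => (congrArg Prod.snd (he s)).symm⟩

theorem xiEnd_mem [Infinite K] {i j : Fin r → Fin n} (hij : i ≤ j) :
    xiEnd K i j ∈ borelSchur K n r := by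
  classical
  by_contra hmem
  obtain ⟨f, hf, hker⟩ := Submodule.exists_le_ker_of_notMem
    (p := Subalgebra.toSubmodule (borelSchur K n r)) (v := xiEnd K i j) hmem
  let c : (Fin r → Fin n) → (Fin r → Fin n) → K := fun p q =>
    f (Matrix.single p q 1)
  have hfa : ∀ M : Matrix (Fin r → Fin n) (Fin r → Fin n) K,
      f M = ∑ p, ∑ q, M p q * c p q := by
    intro M
    conv_lhs => rw [Matrix.matrix_eq_sum_single M]
    simp only [map_sum]
    refine Finset.sum_congr rfl fun p _ => Finset.sum_congr rfl fun q _ => ?_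
    rw [show Matrix.single p q (M p q) = M p q • Matrix.single p q (1 : K) by simp]
    rw [map_smul, smul_eq_mul]
  let F : MvPolynomial (Fin n × Fin n) K :=
    ∑ p, ∑ q, if p ≤ q then MvPolynomial.monomial (∑ s, Finsupp.single (p s, q s) 1) (c p q) else 0
  have hF : F = 0 := by
    refine MvPolynomial.funext_set (fun _ => {x : K | x ≠ 0})
      (fun _ => (Set.finite_singleton (0 : K)).infinite_compl) fun x hx => ?_
    let M : Matrix (Fin n) (Fin n) K := Matrix.of fun k l => if k ≤ l then x (k, l) else 0
    have hM : M.BlockTriangular id := fun k l hkl => if_neg (not_le.mpr hkl)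
    have hdet : M.det ≠ 0 := by
      rw [Matrix.det_of_isUpperTriangular hM]
      refine Finset.prod_ne_zero_iff.mpr fun k _ => ?_
      simpa [M] using hx (k, k) (Set.mem_univ _)
    let g : borel K n := ⟨Matrix.GeneralLinearGroup.mkOfDetNeZero M hdet,
      fun k l hkl => hM hkl⟩
    have hg : f (borelAction K n r g) = 0 := hker (by
      refine ⟨MonoidAlgebra.of K _ g, ?_⟩
      simp)
    rw [hfa] at hg
    rw [map_zero, ← hg]
    simp only [F, map_sum]
    refine Finset.sum_congr rfl fun p _ => Finset.sum_congr rfl fun q _ => ?_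
    rw [borelAction_apply]
    change _ = (∏ s, M (p s) (q s)) * _
    split_ifs with hpq
    · have hp : ∏ s, M (p s) (q s) = ∏ s, x (p s, q s) :=
        Finset.prod_congr rfl fun s _ => if_pos (hpq s)
      rw [hp, MvPolynomial.monomial_eq]
      have : (∑ s, Finsupp.single (p s, q s) 1 : Fin n × Fin n →₀ ℕ).prod
          (fun k e => (MvPolynomial.X k : MvPolynomial (Fin n × Fin n) K) ^ e) =
          ∏ s, MvPolynomial.X (p s, q s) := by
        rw [← Finsupp.prod_finsetSum_index (by simp) (by simp [pow_add])]
        simp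
      rw [this]
      simp [mul_comm]
    · obtain ⟨s, hs⟩ : ∃ s, q s < p s := by simpa [Pi.le_def] using hpq
      rw [Finset.prod_eq_zero (Finset.mem_univ s) (if_neg (not_le.mpr hs))]
      simp
  apply hf
  have h0 := congrArg (MvPolynomial.coeff (∑ s, Finsupp.single (i s, j s) 1)) hF
  rw [hfa, ← MvPolynomial.coeff_zero (∑ s, Finsupp.single (i s, j s) 1), ← h0]
  simp only [F, MvPolynomial.coeff_sum]
  refine Finset.sum_congr rfl fun p _ => Finset.sum_congr rfl fun q _ => ?_
  simp only [xiEnd, Matrix.of_apply]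
  by_cases hs : SameOrbit i j p q
  · obtain ⟨π, rfl, rfl⟩ := hs
    have hle : i ∘ π ≤ j ∘ π := fun s => hij (π s)
    have hsum : (∑ s, Finsupp.single ((i ∘ π) s, (j ∘ π) s) 1 : Fin n × Fin n →₀ ℕ) =
        ∑ s, Finsupp.single (i s, j s) 1 :=
      Equiv.sum_comp π fun s => Finsupp.single (i s, j s) 1
    rw [if_pos hle, if_pos ⟨π, rfl, rfl⟩, MvPolynomial.coeff_monomial, if_pos hsum, one_mul]
  · rw [if_neg hs, zero_mul]
    split_ifs
    · rw [MvPolynomial.coeff_monomial, if_neg fun h => hs (sameOrbit_of_forall_card h)]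
    · simp

variable (K)

/-- The element `ξ_{i,j}` of the Borel–Schur algebra, for `i ≤ j`. -/
noncomputable def xi [Infinite K] (i j : Fin r → Fin n) (hij : i ≤ j) : Alg K n r :=
  ⟨xiEnd K i j, xiEnd_mem hij⟩

theorem xi_mul_xi_self [Infinite K] (i j : Fin r → Fin n) (hij : i ≤ j) :
    xi K i j hij * xi K j j le_rfl = xi K i j hij := by
  classical
  refine Alg.val_injective K n r ?_
  rw [map_mul]
  change xiEnd K i j * xiEnd K j j = xiEnd K i j
  ext p q
  simp only [xiEnd]
  rw [Matrix.mul_apply, Finset.sum_eq_single q]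
  · by_cases h : SameOrbit i j p q
    · obtain ⟨π, rfl, rfl⟩ := h
      simp [show SameOrbit j j (j ∘ π) (j ∘ π) from ⟨π, rfl, rfl⟩]
    · simp [h]
  · intro k _ hk
    have : ¬ SameOrbit j j k q := by
      rintro ⟨π, rfl, rfl⟩
      exact hk rfl
    simp [this]
  · simp

end Algebra

/-! ## Weights -/

/-- The set `Λ(n, r)` of compositions of `r` into `n` nonnegative parts. -/
abbrev Weight (n r : ℕ) : Type := {lam : Fin n → ℕ // ∑ k, lam k = r}

/-- The multi-index `l(λ) = (1,…,1,2,…,2,…,n,…,n)`, with `λ_k` entries equal to `k`: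
the (0-based) entry at place `s` is the number of `k` with `λ_1 + ⋯ + λ_k ≤ s`. -/
def Weight.l {n r : ℕ} (lam : Weight n r) : Fin r → Fin n := fun s =>
  ⟨(Finset.univ.filter fun k : Fin n => ∑ t ∈ Finset.Iic k, lam.1 t ≤ (s : ℕ)).card, by
    have hn : 0 < n := by
      rcases Nat.eq_zero_or_pos n with rfl | h
      · exact absurd s.2 (by simp [← lam.2])
      · exact h
    refine (Finset.card_lt_univ_of_notMem (x := ⟨n - 1, by omega⟩) ?_).trans_eq (by simp)
    have hI : Finset.Iic (⟨n - 1, by omega⟩ : Fin n) = Finset.univ := by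
      ext t; simp only [Finset.mem_Iic, Finset.mem_univ, iff_true, Fin.le_def]; omega
    simp [hI, lam.2]⟩

/-- For `ν` with (0-based) successive places `ν`, `ν + 1`, and `m ≤ λ_{ν+1}`: the composition
`λ(ν, m)`, obtained from `λ` by moving `m` from place `ν + 1` to place `ν`. -/
def Weight.move {n r : ℕ} (lam : Weight n r) (ν : Fin (n - 1)) (m : ℕ)
    (hm : m ≤ lam.1 ⟨ν + 1, by omega⟩) : Weight n r :=
  ⟨fun k => if (k : ℕ) = ν then lam.1 k + m else if (k : ℕ) = ν + 1 then lam.1 k - m else lam.1 k,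
    by
      have h1 : (⟨ν, by omega⟩ : Fin n) ≠ ⟨ν + 1, by omega⟩ := by simp
      refine Eq.trans ?_ lam.2
      rw [← Finset.add_sum_erase _ _ (Finset.mem_univ (⟨ν, by omega⟩ : Fin n)),
        ← Finset.add_sum_erase _ _ (Finset.mem_erase.mpr
          ⟨h1.symm, Finset.mem_univ (⟨ν + 1, by omega⟩ : Fin n)⟩),
        ← Finset.add_sum_erase _ lam.1 (Finset.mem_univ (⟨ν, by omega⟩ : Fin n)),
        ← Finset.add_sum_erase _ lam.1 (Finset.mem_erase.mpr
          ⟨h1.symm, Finset.mem_univ (⟨ν + 1, by omega⟩ : Fin n)⟩)]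
      have hrest : ∀ k ∈ (Finset.univ.erase (⟨ν, by omega⟩ : Fin n)).erase ⟨ν + 1, by omega⟩,
          (if (k : ℕ) = ν then lam.1 k + m else if (k : ℕ) = ν + 1 then lam.1 k - m
            else lam.1 k) = lam.1 k := by
        intro k hk
        simp only [Finset.mem_erase, ne_eq, Fin.ext_iff] at hk
        rw [if_neg hk.2.1, if_neg hk.1]
      rw [Finset.sum_congr rfl hrest]
      simp only [if_true, if_neg (Nat.succ_ne_self (ν : ℕ))]
      rw [← add_assoc, ← add_assoc, add_assoc (lam.1 _) m, Nat.add_sub_cancel' hm]⟩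

theorem Weight.move_l_le {n r : ℕ} (lam : Weight n r) (ν : Fin (n - 1)) (m : ℕ)
    (hm : m ≤ lam.1 ⟨ν + 1, by omega⟩) : (lam.move ν m hm).l ≤ lam.l := by
  intro s
  rw [Fin.le_def]
  simp only [Weight.l]
  refine Finset.card_le_card fun k => ?_
  simp only [Finset.mem_filter, Finset.mem_univ, true_and]
  refine fun h => le_trans ?_ h
  by_cases hk : (k : ℕ) ≤ ν
  · refine Finset.sum_le_sum fun t ht => ?_
    have ht' : (t : ℕ) ≤ k := Fin.le_def.mp (Finset.mem_Iic.mp ht)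
    simp only [Weight.move]
    split_ifs <;> omega
  · -- beyond place `ν` the partial sums agree; compare the complementary sums
    have hc : ∀ μ : Weight n r, ∑ t ∈ Finset.Iic k, μ.1 t + ∑ t ∈ (Finset.Iic k)ᶜ, μ.1 t = r :=
      fun μ => (Finset.sum_add_sum_compl _ _).trans μ.2
    have h2 : ∑ t ∈ (Finset.Iic k)ᶜ, (lam.move ν m hm).1 t ≤ ∑ t ∈ (Finset.Iic k)ᶜ, lam.1 t := by
      refine Finset.sum_le_sum fun t ht => ?_
      have ht' : (k : ℕ) < t := by
        rw [Finset.mem_compl, Finset.mem_Iic, not_le] at ht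
        exact ht
      simp only [Weight.move]
      split_ifs <;> omega
    have := hc lam
    have := hc (lam.move ν m hm)
    omega

/-! ## Modules over the Borel–Schur algebra -/

section Modules

variable (K : Type u) [Field K] {n r : ℕ}

/-- The character of the Borel–Schur algebra at `λ`: the coefficient of `ξ_λ = ξ_{l,l}`,
where `l = l(λ)`. -/
noncomputable def character (lam : Weight n r) : Alg K n r →+* K where
  toFun a := Alg.val K n r a lam.l lam.l
  map_one' := by simp
  map_zero' := by simp
  map_add' a b := by simp
  map_mul' a b := by
    simp only [map_mul, Matrix.mul_apply]
    refine Finset.sum_eq_single _ (fun k _ hk => ?_) (by simp)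
    by_cases h1 : lam.l ≤ k
    · rw [apply_eq_zero_of_mem (Alg.val_mem K n r b) fun h2 => hk (le_antisymm h2 h1), mul_zero]
    · rw [apply_eq_zero_of_mem (Alg.val_mem K n r a) h1, zero_mul]

/-- The one-dimensional simple module `K_λ`: `ξ_λ` acts as the identity and all other basis
elements `ξ_{i,j}` act as zero. -/
def Simple (_lam : Weight n r) : Type u := K

noncomputable instance (lam : Weight n r) : AddCommGroup (Simple K lam) :=
  inferInstanceAs (AddCommGroup K)

noncomputable instance (lam : Weight n r) : Module (Alg K n r) (Simple K lam) :=
  Module.compHom K (character K lam)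

/-- The index set of the summands of `P₁`: pairs `(ν, m)` with `1 ≤ ν ≤ n - 1` (0-based in the
code) and `m ≤ λ_{ν+1}`, where `m = 1` in characteristic zero, and `m` is a power of `p`
(including `p⁰ = 1`) in characteristic `p`. -/
abbrev StepIndex (lam : Weight n r) : Type :=
  {x : Fin (n - 1) × ℕ // x.2 ≤ lam.1 ⟨x.1 + 1, by omega⟩ ∧
    if ringChar K = 0 then x.2 = 1 else ∃ d : ℕ, x.2 = ringChar K ^ d}

instance (lam : Weight n r) : Finite (StepIndex K lam) := by
  refine Finite.of_injective (β := Fin (n - 1) × Fin (∑ k, lam.1 k + 1))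
    (fun x => (x.1.1, ⟨x.1.2, Nat.lt_succ_of_le (x.2.1.trans
      (Finset.single_le_sum (fun _ _ => Nat.zero_le _) (Finset.mem_univ _)))⟩)) fun x y h => ?_
  simp only [Prod.mk.injEq, Fin.mk.injEq] at h
  exact Subtype.ext (Prod.ext h.1 h.2)

noncomputable instance (lam : Weight n r) : Fintype (StepIndex K lam) := Fintype.ofFinite _

/-- The composition `λ(ν, m)` belonging to an index `(ν, m)` of a summand of `P₁`. -/
def StepIndex.weight {lam : Weight n r} (x : StepIndex K lam) : Weight n r :=
  lam.move x.1.1 x.1.2 x.2.1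

variable [Infinite K]

/-- The idempotent `ξ_λ = ξ_{l(λ), l(λ)}`. -/
noncomputable def xiIdem (lam : Weight n r) : Alg K n r := xi K lam.l lam.l le_rfl

/-- The projective module `S(B⁺) ξ_λ`. In the presentation of `K_λ` this is `P₀`. -/
abbrev Proj (lam : Weight n r) : Type u :=
  Submodule.span (Alg K n r) ({xiIdem K lam} : Set (Alg K n r))

/-- The element `ξ_λ` as generator of `S(B⁺) ξ_λ`. -/
noncomputable def Proj.gen (lam : Weight n r) : Proj K lam :=
  ⟨xiIdem K lam, Submodule.mem_span_singleton_self _⟩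

/-- `P₁`, the (finite) direct sum of the `S(B⁺) ξ_{λ(ν, m)}`. -/
abbrev P1 (lam : Weight n r) : Type u :=
  ∀ x : StepIndex K lam, Proj K (x.weight K)

/-- The component `S(B⁺) ξ_{λ(ν, m)} → S(B⁺) ξ_λ` of `p₁`: right multiplication by
`ξ_{l(ν, m), l}`; it maps the generator to `ξ_{l(ν, m), l}`. -/
noncomputable def p1Component {lam : Weight n r} (x : StepIndex K lam) :
    Proj K (x.weight K) →ₗ[Alg K n r] Proj K lam where
  toFun y := ⟨y.1 * xi K (x.weight K).l lam.l (lam.move_l_le _ _ _), by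
    rw [← xi_mul_xi_self K (x.weight K).l lam.l (lam.move_l_le _ _ _), ← mul_assoc]
    exact Submodule.smul_mem _ _ (Submodule.mem_span_singleton_self _)⟩
  map_add' y z := Subtype.ext (add_mul _ _ _)
  map_smul' a y := Subtype.ext (mul_assoc _ _ _)

/-- The map `p₁ : P₁ → P₀` of the projective presentation `P₁ → P₀ → K_λ → 0`. -/
noncomputable def p1 (lam : Weight n r) : P1 K lam →ₗ[Alg K n r] Proj K lam :=
  ∑ x, p1Component K x ∘ₗ LinearMap.proj x

/-- The embedding `θ` of `K_λ` into the image `D P₀ᵗ` of `P₀` under the Nakayama functor: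
`θ(c)(η) = η c`, where `φ ∈ Hom(P₀, S(B⁺))` is identified with `η = φ(ξ_λ) ∈ ξ_λ S(B⁺)`. -/
noncomputable def theta (lam : Weight n r) :
    Simple K lam →ₗ[Alg K n r] Nakayama K (Alg K n r) (Proj K lam) where
  toFun c :=
    { toFun := fun φ => (φ (Proj.gen K lam) • c : Simple K lam)
      map_add' := fun φ ψ => add_smul (φ (Proj.gen K lam)) (ψ (Proj.gen K lam)) c
      map_smul' := fun k φ => by
        exact mul_assoc _ _ _ }
  map_add' c d := LinearMap.ext fun φ => smul_add (φ (Proj.gen K lam)) c d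
  map_smul' a c := LinearMap.ext fun φ =>
    (mul_smul (φ (Proj.gen K lam)) a c).symm

/-- `τ K_λ`, the kernel of `D p₁ᵗ : D P₁ᵗ → D P₀ᵗ`. -/
noncomputable abbrev tau (lam : Weight n r) :
    Submodule (Alg K n r) (Nakayama K (Alg K n r) (P1 K lam)) :=
  LinearMap.ker (Nakayama.map K (Alg K n r) (p1 K lam))

/-- The middle term `E(λ) = {(z, c) ∈ D P₁ᵗ ⊕ K_λ | D p₁ᵗ (z) = θ(c)}`. -/
noncomputable abbrev middle (lam : Weight n r) : Submodule (Alg K n r)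
    (Nakayama K (Alg K n r) (P1 K lam) × Simple K lam) :=
  LinearMap.eqLocus
    (Nakayama.map K (Alg K n r) (p1 K lam) ∘ₗ LinearMap.fst _ _ _)
    (theta K lam ∘ₗ LinearMap.snd _ _ _)

/-- The map `f : τ K_λ → E(λ)`, `z ↦ (z, 0)`. -/
noncomputable def middleInl (lam : Weight n r) :
    tau K lam →ₗ[Alg K n r] middle K lam :=
  LinearMap.codRestrict (middle K lam) (LinearMap.inl _ _ _ ∘ₗ (tau K lam).subtype) fun z => by
    have hz : Nakayama.map K (Alg K n r) (p1 K lam) z.1 = 0 := z.2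
    change Nakayama.map K (Alg K n r) (p1 K lam) z.1 = theta K lam 0
    rw [hz, map_zero]

/-- The map `g : E(λ) → K_λ`, `(z, c) ↦ c`. -/
noncomputable def middleSnd (lam : Weight n r) :
    middle K lam →ₗ[Alg K n r] Simple K lam :=
  LinearMap.snd _ _ _ ∘ₗ (middle K lam).subtype

end Modules

end BorelSchur

open BorelSchur

namespace BorelSchur

/-! ## Products of basis elements -/

section Algebra

variable {K : Type u} [Field K] {n r : ℕ}

/-! Both claims reduce to the case where `StepIndex` has exactly one element `x₀`. An indecomposable
`P₁` has a single summand, and for n = 2 in characteristic 0 the only index is (0, 1). Since (ν, 1)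
is an index whenever (ν, m) is, the unique index has m = 1. Write μ = λ(ν, 1) and ξ = ξ_{l(μ),l(λ)}.

Uniqueness restricts λ: in 0-based numbering it is supported at the places 0 and ν + 1, and in
characteristic p also λ_{ν+1} < p. Under this restriction the product rule `xiEnd_mul_xiEnd_update`
has invertible coefficients, so modulo Sξ every element of S ξ_λ is a multiple of ξ_λ
(`exists_mul_xiIdem_eq`).

The dual of Hom(P₁, S) = ξ_μ S has an essential simple socle because ξ_μ S ξ_μ = K ξ_μ: every
nonzero functional can be moved to the coefficient functional of ξ_μ (`exists_socle_functional`).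
Both τK_λ and E(λ) embed in this module and are nonzero, so they inherit the property. This gives
the simple socle of E(λ) and indecomposability of both.

The Auslander–Reiten property is checked directly. If h : X → K_λ is not a split epimorphism, then
ξx = 0 forces h(x) = 0, since otherwise ξ_λ x would span a copy of K_λ mapped isomorphically by h.
Hence h(x) = f(ξx) for some K-linear f, and x ↦ (φ ↦ f(φ(gen) x)) is the first coordinate of a lift
of h to E(λ) (`exists_lift_middleSnd`). -/

theorem apply_comp_perm_of_mem {a : TensorEnd K n r} (ha : a ∈ borelSchur K n r)
    (p q : Fin r → Fin n) (π : Equiv.Perm (Fin r)) : a (p ∘ π) (q ∘ π) = a p q := by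
  obtain ⟨x, rfl⟩ := ha
  induction x using MonoidAlgebra.induction_on with
  | of g =>
    have h : borelAction K n r g (p ∘ π) (q ∘ π) = borelAction K n r g p q := by
      rw [borelAction_apply, borelAction_apply]
      exact Equiv.prod_comp π fun s => ((g : GL (Fin n) K) : Matrix (Fin n) (Fin n) K) (p s) (q s)
    simpa using h
  | add x y hx hy =>
    simp only [AlgHom.toRingHom_eq_coe, RingHom.coe_coe, map_add, Matrix.add_apply] at hx hy ⊢
    rw [hx, hy]
  | smul c x hx =>
    simp only [AlgHom.toRingHom_eq_coe, RingHom.coe_coe, map_smul, Matrix.smul_apply] at hx ⊢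
    rw [hx]

/-! ### Orbits of pairs of multi-indices, and entries of ξ_{i,j}. -/

theorem SameOrbit.refl (i j : Fin r → Fin n) : SameOrbit i j i j := ⟨1, rfl, rfl⟩

theorem SameOrbit.symm {i j p q : Fin r → Fin n} (h : SameOrbit i j p q) : SameOrbit p q i j := by
  obtain ⟨π, rfl, rfl⟩ := h
  exact ⟨π⁻¹, funext fun s => by simp, funext fun s => by simp⟩

theorem SameOrbit.trans {i j p q u v : Fin r → Fin n} (h : SameOrbit i j p q)
    (h' : SameOrbit p q u v) : SameOrbit i j u v := by
  obtain ⟨π, rfl, rfl⟩ := h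
  obtain ⟨σ, rfl, rfl⟩ := h'
  exact ⟨π * σ, rfl, rfl⟩

theorem sameOrbit_comp (i j : Fin r → Fin n) (π : Equiv.Perm (Fin r)) :
    SameOrbit i j (i ∘ π) (j ∘ π) := ⟨π, rfl, rfl⟩

variable (n r) in
/-- The setoid of orbits of the symmetric group on pairs of multi-indices. -/
def orbitSetoid : Setoid ((Fin r → Fin n) × (Fin r → Fin n)) where
  r x y := SameOrbit x.1 x.2 y.1 y.2
  iseqv := ⟨fun _ => .refl _ _, fun h => h.symm, fun h h' => h.trans h'⟩

theorem xiEnd_apply_of_sameOrbit {i j p q : Fin r → Fin n} (h : SameOrbit i j p q) :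
    xiEnd K i j p q = 1 := if_pos h

theorem xiEnd_apply_of_not_sameOrbit {i j p q : Fin r → Fin n} (h : ¬ SameOrbit i j p q) :
    xiEnd K i j p q = 0 := if_neg h

/-- A rearrangement preserves the sum of the entries, while a strict componentwise inequality
increases it. This is how triangularity forces equality inside a weight space. -/
theorem eq_of_le_of_comp_perm {p q : Fin r → Fin n} (h : p ≤ q) {π : Equiv.Perm (Fin r)}
    (hπ : p = q ∘ π) : p = q := by
  by_contra hne
  obtain ⟨s, hs⟩ : ∃ s, p s < q s := by
    by_contra! hc
    exact hne (le_antisymm h hc)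
  have h1 : ∑ s, (p s : ℕ) < ∑ s, (q s : ℕ) :=
    Finset.sum_lt_sum (fun t _ => h t) ⟨s, Finset.mem_univ s, hs⟩
  have h2 : ∑ s, (p s : ℕ) = ∑ s, (q s : ℕ) := by
    rw [hπ]
    exact Equiv.sum_comp π fun s => (q s : ℕ)
  omega

theorem xiEnd_comp_perm (i j : Fin r → Fin n) (π : Equiv.Perm (Fin r)) :
    xiEnd K (i ∘ π) (j ∘ π) = xiEnd K i j := by
  ext p q
  by_cases h : SameOrbit i j p q
  · rw [xiEnd_apply_of_sameOrbit h,
      xiEnd_apply_of_sameOrbit ((sameOrbit_comp i j π).symm.trans h)]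
  · rw [xiEnd_apply_of_not_sameOrbit h,
      xiEnd_apply_of_not_sameOrbit fun h' => h ((sameOrbit_comp i j π).trans h')]

theorem xiEnd_self_apply (l p q : Fin r → Fin n) [Decidable (p = q ∧ SameOrbit l l p p)] :
    xiEnd K l l p q = if p = q ∧ SameOrbit l l p p then 1 else 0 := by
  split_ifs with h
  · obtain ⟨rfl, h⟩ := h
    exact xiEnd_apply_of_sameOrbit h
  · refine xiEnd_apply_of_not_sameOrbit fun h' => h ?_
    obtain ⟨π, rfl, rfl⟩ := h'
    exact ⟨rfl, sameOrbit_comp _ _ _⟩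

theorem mul_xiEnd_self_apply (a : TensorEnd K n r) (l p q : Fin r → Fin n)
    [Decidable (SameOrbit l l q q)] :
    (a * xiEnd K l l) p q = if SameOrbit l l q q then a p q else 0 := by
  classical
  rw [Matrix.mul_apply, Finset.sum_eq_single q]
  · rw [xiEnd_self_apply]
    simp
  · intro k _ hk
    rw [xiEnd_self_apply, if_neg fun h => hk h.1, mul_zero]
  · simp

theorem xiEnd_self_mul_apply (a : TensorEnd K n r) (l p q : Fin r → Fin n)
    [Decidable (SameOrbit l l p p)] :
    (xiEnd K l l * a) p q = if SameOrbit l l p p then a p q else 0 := by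
  classical
  rw [Matrix.mul_apply, Finset.sum_eq_single p]
  · rw [xiEnd_self_apply]
    simp
  · intro k _ hk
    rw [xiEnd_self_apply, if_neg fun h => hk h.1.symm, zero_mul]
  · simp

/-! ### Characters and the idempotents ξ_λ. -/

theorem character_smul (lam : Weight n r) (c : K) (a : Alg K n r) :
    character K lam (c • a) = c * character K lam a := by
  change Alg.val K n r (c • a) lam.l lam.l = _
  rw [map_smul]
  rfl

theorem character_algebraMap (lam : Weight n r) (c : K) :
    character K lam (algebraMap K (Alg K n r) c) = c := by
  rw [Algebra.algebraMap_eq_smul_one, character_smul, map_one, mul_one]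

variable [Infinite K]

theorem val_xi (i j : Fin r → Fin n) (hij : i ≤ j) : Alg.val K n r (xi K i j hij) = xiEnd K i j :=
  rfl

theorem val_xiIdem (lam : Weight n r) :
    Alg.val K n r (xiIdem K lam) = xiEnd K lam.l lam.l := rfl

theorem xi_mul_xiIdem {i : Fin r → Fin n} {lam : Weight n r} (h : i ≤ lam.l) :
    xi K i lam.l h * xiIdem K lam = xi K i lam.l h := xi_mul_xi_self K _ _ h

theorem xiIdem_mul_self (lam : Weight n r) : xiIdem K lam * xiIdem K lam = xiIdem K lam :=
  xi_mul_xi_self K _ _ le_rfl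

theorem xiIdem_mul_xi {lam : Weight n r} {j : Fin r → Fin n} (h : lam.l ≤ j) :
    xiIdem K lam * xi K lam.l j h = xi K lam.l j h := by
  classical
  refine Alg.val_injective K n r ?_
  rw [map_mul, val_xiIdem, val_xi]
  ext p q
  rw [xiEnd_self_mul_apply]
  split_ifs with hp
  · rfl
  · rw [xiEnd_apply_of_not_sameOrbit]
    rintro ⟨π, rfl, rfl⟩
    exact hp (sameOrbit_comp _ _ _)

/-- The weight space algebra `ξ_λ S ξ_λ` is `K ξ_λ`. -/
theorem xiIdem_mul_mul_xiIdem (lam : Weight n r) (a : Alg K n r) :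
    xiIdem K lam * a * xiIdem K lam = character K lam a • xiIdem K lam := by
  classical
  refine Alg.val_injective K n r ?_
  rw [map_smul, map_mul, map_mul, val_xiIdem]
  ext p q
  rw [mul_xiEnd_self_apply, xiEnd_self_mul_apply, Matrix.smul_apply, xiEnd_self_apply, smul_eq_mul]
  have ha := Alg.val_mem K n r a
  by_cases hq : SameOrbit lam.l lam.l q q
  · by_cases hp : SameOrbit lam.l lam.l p p
    · rw [if_pos hq, if_pos hp]
      by_cases hpq : p = q
      · subst hpq
        rw [if_pos ⟨rfl, hp⟩, mul_one]
        obtain ⟨π, rfl, -⟩ := hp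
        exact apply_comp_perm_of_mem ha _ _ _
      · rw [if_neg fun h => hpq h.1, mul_zero]
        -- Two distinct rearrangements of l(λ) are never comparable, so the triangular matrix a
        -- vanishes here.
        refine apply_eq_zero_of_mem ha fun hle => hpq ?_
        obtain ⟨π, rfl, -⟩ := hp
        obtain ⟨σ, rfl, -⟩ := hq
        exact eq_of_le_of_comp_perm hle (π := σ⁻¹ * π) (funext fun s => by simp)
    · rw [if_pos hq, if_neg hp, if_neg fun h => hp h.2, mul_zero]
  · rw [if_neg hq, if_neg fun h : p = q ∧ SameOrbit lam.l lam.l p p => hq (h.1 ▸ h.2), mul_zero]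

theorem character_xiIdem (lam : Weight n r) : character K lam (xiIdem K lam) = 1 :=
  xiEnd_apply_of_sameOrbit (.refl _ _)

theorem character_xi_of_ne {i j : Fin r → Fin n} (hij : i ≤ j) (hne : i ≠ j) (lam : Weight n r) :
    character K lam (xi K i j hij) = 0 := by
  refine xiEnd_apply_of_not_sameOrbit fun h => hne ?_
  obtain ⟨π, hi, hj⟩ := h
  exact π.surjective.injective_comp_right (hi.symm.trans hj)

theorem xiIdem_ne_zero (lam : Weight n r) : xiIdem K lam ≠ 0 := fun h => by
  simpa [h] using character_xiIdem (K := K) lam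

/-- The basis elements `ξ_{i,j}` span the Borel–Schur algebra. -/
theorem span_xi_eq_top :
    Submodule.span K {a : Alg K n r | ∃ (i j : Fin r → Fin n) (h : i ≤ j), a = xi K i j h} = ⊤ := by
  classical
  refine eq_top_iff.mpr fun a _ => ?_
  -- The entries of a are constant on orbits, so a is a sum over orbits with coefficients read off
  -- at representatives. Orbits with i ≰ j contribute nothing, which justifies the default value 0.
  let f : Quotient (orbitSetoid n r) → Alg K n r := fun o =>
    if h : o.out.1 ≤ o.out.2 then Alg.val K n r a o.out.1 o.out.2 • xi K o.out.1 o.out.2 h else 0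
  have hf : ∀ o, Alg.val K n r (f o) =
      Alg.val K n r a o.out.1 o.out.2 • xiEnd K o.out.1 o.out.2 := by
    intro o
    simp only [f]
    split_ifs with h
    · rw [map_smul, val_xi]
    · rw [apply_eq_zero_of_mem (Alg.val_mem K n r a) h, map_zero, zero_smul]
  have ha : a = ∑ o, f o := by
    refine Alg.val_injective K n r ?_
    rw [map_sum]
    ext p q
    rw [Matrix.sum_apply, Finset.sum_eq_single (Quotient.mk (orbitSetoid n r) (p, q))]
    · have h : SameOrbit _ _ p q := Quotient.mk_out (s := orbitSetoid n r) (p, q)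
      rw [hf, Matrix.smul_apply, xiEnd_apply_of_sameOrbit h, smul_eq_mul, mul_one]
      obtain ⟨π, hp, hq⟩ := h
      have hinv := apply_comp_perm_of_mem (Alg.val_mem K n r a)
        (Quotient.mk (orbitSetoid n r) (p, q)).out.1 (Quotient.mk (orbitSetoid n r) (p, q)).out.2 π
      rw [← hp, ← hq] at hinv
      exact hinv
    · intro o _ ho
      rw [hf, Matrix.smul_apply, xiEnd_apply_of_not_sameOrbit, smul_zero]
      intro h
      refine ho ?_
      rw [← Quotient.out_eq o]
      exact Quotient.sound (s := orbitSetoid n r) h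
    · simp
  rw [ha]
  refine Submodule.sum_mem _ fun o _ => ?_
  simp only [f]
  split_ifs with h
  · exact Submodule.smul_mem _ _ (Submodule.subset_span ⟨_, _, h, rfl⟩)
  · exact Submodule.zero_mem _

theorem xi_mul_xiIdem_of_not_sameOrbit {i j : Fin r → Fin n} (hij : i ≤ j) (lam : Weight n r)
    (h : ¬ SameOrbit lam.l lam.l j j) : xi K i j hij * xiIdem K lam = 0 := by
  classical
  refine Alg.val_injective K n r ?_
  rw [map_mul, val_xiIdem, val_xi, map_zero]
  ext p q
  rw [mul_xiEnd_self_apply]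
  split_ifs with hq
  · rw [Matrix.zero_apply, xiEnd_apply_of_not_sameOrbit]
    rintro ⟨π, rfl, rfl⟩
    exact h (hq.trans (sameOrbit_comp j j π).symm)
  · rfl

end Algebra

/-! ## The multi-index of a weight -/

section Weight

variable {n r : ℕ}

/-- The places whose partial sum is at most s form an initial segment, so its cardinality exceeds k
exactly when k belongs to it. -/
theorem Weight.lt_l_iff (lam : Weight n r) (s : Fin r) (k : Fin n) :
    k < lam.l s ↔ ∑ t ∈ Finset.Iic k, lam.1 t ≤ s := by
  set F : Finset (Fin n) := Finset.univ.filter fun k : Fin n => ∑ t ∈ Finset.Iic k, lam.1 t ≤ s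
    with hF
  have hl : (lam.l s : ℕ) = F.card := rfl
  have hdown : ∀ k ∈ F, ∀ k' ≤ k, k' ∈ F := by
    intro k hk k' hk'
    simp only [hF, Finset.mem_filter, Finset.mem_univ, true_and] at hk ⊢
    exact (Finset.sum_le_sum_of_subset (Finset.Iic_subset_Iic.mpr hk')).trans hk
  have hmem : k ∈ F ↔ ∑ t ∈ Finset.Iic k, lam.1 t ≤ s := by simp [hF]
  rw [← hmem, Fin.lt_def, hl]
  constructor
  · intro h
    by_contra hk
    have : F ⊆ Finset.Iio k := fun k' hk' =>
      Finset.mem_Iio.mpr (lt_of_not_ge fun hc => hk (hdown _ hk' _ hc))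
    have := Finset.card_le_card this
    rw [Fin.card_Iio] at this
    omega
  · intro hk
    have : Finset.Iic k ⊆ F := fun k' hk' => hdown _ hk _ (Finset.mem_Iic.mp hk')
    have := Finset.card_le_card this
    rw [Fin.card_Iic] at this
    omega

theorem Weight.sum_Iic_succ (lam : Weight n r) (k : ℕ) (hk : k + 1 < n) :
    ∑ t ∈ Finset.Iic (⟨k + 1, hk⟩ : Fin n), lam.1 t =
      ∑ t ∈ Finset.Iic (⟨k, by omega⟩ : Fin n), lam.1 t + lam.1 ⟨k + 1, hk⟩ := by
  have : Finset.Iic (⟨k + 1, hk⟩ : Fin n) =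
      insert ⟨k + 1, hk⟩ (Finset.Iic (⟨k, by omega⟩ : Fin n)) := by
    ext t
    simp only [Finset.mem_Iic, Finset.mem_insert, Fin.le_def, Fin.ext_iff]
    omega
  rw [this, Finset.sum_insert (by simp [Fin.le_def]), add_comm]

theorem Weight.sum_Iic_le (lam : Weight n r) (k : Fin n) :
    ∑ t ∈ Finset.Iic k, lam.1 t ≤ r := by
  conv_rhs => rw [← lam.2]
  exact Finset.sum_le_sum_of_subset (Finset.subset_univ _)

theorem Weight.l_eq_succ_iff (lam : Weight n r) (s : Fin r) (k : ℕ) (hk : k + 1 < n) :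
    lam.l s = ⟨k + 1, hk⟩ ↔ ∑ t ∈ Finset.Iic (⟨k, by omega⟩ : Fin n), lam.1 t ≤ s ∧
      (s : ℕ) < ∑ t ∈ Finset.Iic (⟨k, by omega⟩ : Fin n), lam.1 t + lam.1 ⟨k + 1, hk⟩ := by
  rw [← lam.sum_Iic_succ k hk, ← lam.lt_l_iff, ← not_le (b := (s : ℕ)), ← lam.lt_l_iff]
  simp only [Fin.lt_def, Fin.ext_iff]
  omega

theorem Weight.card_l_eq_succ_le (lam : Weight n r) (k : ℕ) (hk : k + 1 < n) :
    (Finset.univ.filter fun s => lam.l s = ⟨k + 1, hk⟩).card ≤ lam.1 ⟨k + 1, hk⟩ := by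
  set S := ∑ t ∈ Finset.Iic (⟨k, by omega⟩ : Fin n), lam.1 t
  have : ((Finset.univ.filter fun s => lam.l s = ⟨k + 1, hk⟩).map Fin.valEmbedding) ⊆
      Finset.Ico S (S + lam.1 ⟨k + 1, hk⟩) := by
    intro s hs
    obtain ⟨s, h, rfl⟩ := Finset.mem_map.mp hs
    exact Finset.mem_Ico.mpr ((lam.l_eq_succ_iff s k hk).mp (Finset.mem_filter.mp h).2)
  simpa using Finset.card_le_card this

/-- Moving m from place ν + 1 to ν changes only the partial sum ending at ν. Since l is determined
by partial sums, this controls l(λ(ν, m)). -/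
theorem Weight.sum_Iic_move (lam : Weight n r) (ν : Fin (n - 1)) (m : ℕ)
    (hm : m ≤ lam.1 ⟨ν + 1, by omega⟩) (k : Fin n) :
    ∑ t ∈ Finset.Iic k, (lam.move ν m hm).1 t =
      ∑ t ∈ Finset.Iic k, lam.1 t + if (k : ℕ) = ν then m else 0 := by
  obtain ⟨k, hk⟩ := k
  have h0 : ∀ k (hk : k < n), ∑ t ∈ Finset.Iic (⟨k, hk⟩ : Fin n), (lam.move ν m hm).1 t +
      (if k = ν + 1 then m else 0) = ∑ t ∈ Finset.Iic (⟨k, hk⟩ : Fin n), lam.1 t +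
      (if k = ν then m else 0) + (if k = ν + 1 then m else 0) := by
    intro k
    induction k with
    | zero =>
      intro hk
      have hI : Finset.Iic (⟨0, hk⟩ : Fin n) = {⟨0, hk⟩} := by
        ext t
        simp [Fin.le_def, Fin.ext_iff]
      rw [hI, Finset.sum_singleton, Finset.sum_singleton]
      have h1 : ¬ 0 = (ν : ℕ) + 1 := by omega
      simp only [Weight.move, h1, if_false]
      split_ifs <;> rfl
    | succ k ih =>
      intro hk
      have h := ih (by omega)
      rw [Weight.sum_Iic_succ, Weight.sum_Iic_succ]
      -- In this additive form the truncated subtraction disappears; the case k = ν needs m ≤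
      -- λ_{ν+1}.
      have h2 : (lam.move ν m hm).1 ⟨k + 1, hk⟩ + (if k = ν then m else 0) =
          lam.1 ⟨k + 1, hk⟩ + (if k + 1 = ν then m else 0) := by
        simp only [Weight.move]
        by_cases h1 : k = ν
        · subst h1
          have hm' : m ≤ lam.1 ⟨ν + 1, hk⟩ := hm
          simp [hm']
        · simp only [if_neg h1, add_left_inj]
          split_ifs <;> omega
      omega
  exact Nat.add_right_cancel (h0 k hk)

/-- The position that changes is the first one carrying the entry ν + 1, namely the partial sum S of
λ through ν. -/
theorem Weight.exists_move_one_l_eq_update (lam : Weight n r) (ν : Fin (n - 1))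
    (hm : 1 ≤ lam.1 ⟨ν + 1, by omega⟩) :
    ∃ t, lam.l t = ⟨ν + 1, by omega⟩ ∧
      (lam.move ν 1 hm).l = Function.update lam.l t ⟨ν, by omega⟩ := by
  have hS := lam.sum_Iic_succ ν (by omega)
  have hr := lam.sum_Iic_le ⟨ν + 1, by omega⟩
  set S := ∑ t ∈ Finset.Iic (⟨ν, by omega⟩ : Fin n), lam.1 t with hSdef
  have ht : lam.l ⟨S, by omega⟩ = ⟨ν + 1, by omega⟩ := by
    rw [lam.l_eq_succ_iff]
    simp only [← hSdef]
    omega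
  refine ⟨⟨S, by omega⟩, ht, funext fun s => ?_⟩
  have key : ∀ k, k < (lam.move ν 1 hm).l s ↔
      ∑ t ∈ Finset.Iic k, lam.1 t + (if (k : ℕ) = ν then 1 else 0) ≤ s := fun k => by
    rw [Weight.lt_l_iff, Weight.sum_Iic_move]
  refine eq_of_forall_lt_iff fun k => (key k).trans ?_
  by_cases hs : s = ⟨S, by omega⟩
  · subst hs
    have h1 := lam.lt_l_iff ⟨S, by omega⟩ k
    rw [ht] at h1
    simp only [Function.update_self, Fin.lt_def] at h1 ⊢
    by_cases hk : (k : ℕ) = ν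
    · have : k = ⟨ν, by omega⟩ := Fin.ext hk
      simp [this, ← hSdef]
    · rw [if_neg hk, add_zero, ← h1]
      omega
  · rw [Function.update_of_ne hs, Weight.lt_l_iff]
    by_cases hk : (k : ℕ) = ν
    · have : k = ⟨ν, by omega⟩ := Fin.ext hk
      have hne : (s : ℕ) ≠ S := fun h => hs (Fin.ext h)
      simp only [this, if_true, ← hSdef]
      omega
    · rw [if_neg hk, add_zero]

theorem Weight.l_ne_move_one_l (lam : Weight n r) (ν : Fin (n - 1))
    (hm : 1 ≤ lam.1 ⟨ν + 1, by omega⟩) : (lam.move ν 1 hm).l ≠ lam.l := by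
  obtain ⟨t, ht, h⟩ := lam.exists_move_one_l_eq_update ν hm
  intro h'
  have := congrFun (h.symm.trans h') t
  rw [Function.update_self, ht] at this
  simp at this

end Weight

/-! ## Generation of the radical of `S ξ_λ` -/

section Radical

variable {K : Type u} [Field K] {n r : ℕ}

/-! ### The product of ξ_{i,j} and ξ_{j,l} when j differs from l in one place. -/

/-- The transposition of π t and t₀ fixes both i and j, so it may be composed with π without
changing the rearranged pair. -/
theorem exists_perm_apply_eq {i j : Fin r → Fin n} {π : Equiv.Perm (Fin r)} {t t₀ : Fin r}
    (hi : i (π t) = i t₀) (hj : j (π t) = j t₀) :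
    ∃ σ : Equiv.Perm (Fin r), σ t = t₀ ∧ i ∘ σ = i ∘ π ∧ j ∘ σ = j ∘ π := by
  have key : ∀ f : Fin r → Fin n, f (π t) = f t₀ → f ∘ (Equiv.swap (π t) t₀ * π) = f ∘ π := by
    intro f hf
    funext s
    simp only [Function.comp_apply, Equiv.Perm.coe_mul, Equiv.swap_apply_def]
    split_ifs with h1 h2
    · rw [h1, hf]
    · rw [h2, hf]
    · rfl
  exact ⟨Equiv.swap (π t) t₀ * π, by simp, key i hi, key j hj⟩

/-- This lists the intermediate indices k contributing to the (p, l) entry of ξ_{i,j} ξ_{j,l}, with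
j the update of l: each comes from lowering one entry of l equal to l t₀ at a place t where p t = i
t₀. -/
theorem sameOrbit_and_sameOrbit_update_iff {l i : Fin r → Fin n} {t₀ : Fin r} {v : Fin n}
    (hl : ∀ s, (l s : ℕ) = 0 ∨ l s = l t₀) (hv : v < l t₀) (hi : i ≤ Function.update l t₀ v)
    (p k : Fin r → Fin n) :
    SameOrbit i (Function.update l t₀ v) p k ∧ SameOrbit (Function.update l t₀ v) l k l ↔
      SameOrbit i l p l ∧ ∃ t, l t = l t₀ ∧ p t = i t₀ ∧ k = Function.update l t v := by
  set j := Function.update l t₀ v with hj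
  have hj₀ : j t₀ = v := Function.update_self _ _ _
  have hjs : ∀ s, s ≠ t₀ → j s = l s := fun s hs => Function.update_of_ne hs _ _
  constructor
  · rintro ⟨⟨ρ, hp, hk⟩, ⟨π, hk', hl'⟩⟩
    have ht₀ : π (π⁻¹ t₀) = t₀ := by simp
    generalize π⁻¹ t₀ = t at ht₀
    have hlt : l t = l t₀ := by
      rw [← ht₀]
      exact congrFun hl' t
    have hkt : k = Function.update l t v := by
      funext s
      by_cases hs : s = t
      · rw [hs, Function.update_self, hk', Function.comp_apply, ht₀, hj₀]
      · rw [Function.update_of_ne hs, hk', Function.comp_apply, hjs]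
        · exact (congrFun hl' s).symm
        · exact fun h => hs (π.injective (h.trans ht₀.symm))
    have hjρ : j (ρ t) = v := by
      have := congrFun hk t
      rw [hkt, Function.update_self] at this
      exact this.symm
    -- The support condition enters here. If ρ t ≠ t₀, then l takes the value v at ρ t, so v = 0;
    -- then i ≤ j makes both i (ρ t) and i t₀ zero.
    have hiρ : i (ρ t) = i t₀ := by
      by_cases h : ρ t = t₀
      · rw [h]
      · have h1 := hl (ρ t)
        rw [← hjs _ h, hjρ] at h1
        have h2 : (v : ℕ) = 0 := h1.resolve_right hv.ne
        have h3 := hi (ρ t)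
        have h4 := hi t₀
        rw [hjρ, Fin.le_def] at h3
        rw [hj₀, Fin.le_def] at h4
        exact Fin.ext (by omega)
    obtain ⟨σ, hσ, hiσ, hjσ⟩ := exists_perm_apply_eq hiρ (hjρ.trans hj₀.symm)
    rw [← hp] at hiσ
    rw [← hk] at hjσ
    refine ⟨⟨σ, hiσ.symm, funext fun s => ?_⟩, t, hlt, ?_, hkt⟩
    · by_cases hs : s = t
      · rw [hs, Function.comp_apply, hσ, hlt]
      · rw [Function.comp_apply, ← hjs (σ s) fun h => hs (σ.injective (h.trans hσ.symm))]
        change l s = (j ∘ σ) s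
        rw [hjσ, hkt, Function.update_of_ne hs]
    · rw [← hiσ, Function.comp_apply, hσ]
  · rintro ⟨⟨π, hp, hl'⟩, t, hlt, hpt, rfl⟩
    have h1 : i (π t) = i t₀ := by rw [← hpt, hp, Function.comp_apply]
    have h2 : l (π t) = l t₀ := by
      rw [← hlt]
      exact (congrFun hl' t).symm
    obtain ⟨σ, hσ, hiσ, hlσ⟩ := exists_perm_apply_eq h1 h2
    rw [← hp] at hiσ
    rw [← hl'] at hlσ
    have hk : Function.update l t v = j ∘ σ := by
      funext s
      by_cases hs : s = t
      · rw [hs, Function.update_self, Function.comp_apply, hσ, hj₀]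
      · rw [Function.update_of_ne hs, Function.comp_apply,
          hjs (σ s) fun h => hs (σ.injective (h.trans hσ.symm))]
        exact (congrFun hlσ s).symm
    exact ⟨⟨σ, hiσ.symm, hk⟩, ⟨σ, hk, hlσ.symm⟩⟩

/-! ### The index set of the summands of P₁. -/

theorem StepIndex.one_property (lam : Weight n r) (ν : Fin (n - 1))
    (hm : 1 ≤ lam.1 ⟨ν + 1, by omega⟩) : 1 ≤ lam.1 ⟨ν + 1, by omega⟩ ∧
      if ringChar K = 0 then 1 = 1 else ∃ d : ℕ, 1 = ringChar K ^ d :=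
  ⟨hm, by
    split_ifs
    · rfl
    · exact ⟨0, (pow_zero _).symm⟩⟩

/-- Every admissible m is at least 1, so (ν, 1) is admissible as soon as (ν, m) is. -/
theorem StepIndex.exists_eq_of_unique {lam : Weight n r} {x₀ : StepIndex K lam}
    (h₀ : ∀ x, x = x₀) : ∃ (ν : Fin (n - 1)) (hm : 1 ≤ lam.1 ⟨ν + 1, by omega⟩),
      x₀ = ⟨(ν, 1), StepIndex.one_property lam ν hm⟩ := by
  refine ⟨x₀.1.1, ?_, (h₀ _).symm⟩
  refine le_trans ?_ x₀.2.1
  have := x₀.2.2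
  split_ifs at this with hK
  · exact this.ge
  · obtain ⟨d, hd⟩ := this
    rw [hd]
    exact Nat.one_le_pow _ _ (Nat.pos_of_ne_zero hK)

theorem StepIndex.weight_l_le {lam : Weight n r} (x : StepIndex K lam) :
    (x.weight K).l ≤ lam.l := lam.move_l_le _ _ _

theorem StepIndex.weight_l_ne {lam : Weight n r} {x₀ : StepIndex K lam} (h₀ : ∀ x, x = x₀) :
    (x₀.weight K).l ≠ lam.l := by
  obtain ⟨ν, hm, hx⟩ := StepIndex.exists_eq_of_unique h₀
  rw [hx] at h₀ ⊢
  exact lam.l_ne_move_one_l ν hm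

/-- For `n = 2` in characteristic zero there is at most one summand in `P₁`. -/
theorem StepIndex.exists_forall_eq_of_ringChar_eq_zero {r : ℕ} {lam : Weight 2 r}
    (hK : ringChar K = 0) (hlam : lam.1 1 ≠ 0) : ∃ x₀ : StepIndex K lam, ∀ x, x = x₀ := by
  refine ⟨⟨(0, 1), Nat.one_le_iff_ne_zero.mpr hlam, by rw [if_pos hK]⟩, ?_⟩
  rintro ⟨⟨ν, m⟩, hm, hx⟩
  rw [if_pos hK] at hx
  exact Subtype.ext (Prod.ext (Subsingleton.elim (α := Fin 1) _ _) hx)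

variable [Infinite K]

/-- The product rule `ξ_{i,j} ξ_{j,l} = N ξ_{i,l}` when `j` differs from `l` in one place. -/
theorem xiEnd_mul_xiEnd_update {l i : Fin r → Fin n} {t₀ : Fin r} {v : Fin n}
    (hl : ∀ s, (l s : ℕ) = 0 ∨ l s = l t₀) (hv : v < l t₀) (hi : i ≤ Function.update l t₀ v) :
    xiEnd K i (Function.update l t₀ v) * xiEnd K (Function.update l t₀ v) l =
      ((Finset.univ.filter fun t => l t = l t₀ ∧ i t = i t₀).card : K) • xiEnd K i l := by
  classical
  have hjl : Function.update l t₀ v ≤ l := by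
    intro s
    by_cases hs : s = t₀
    · rw [hs, Function.update_self]
      exact hv.le
    · rw [Function.update_of_ne hs]
  have hkey := sameOrbit_and_sameOrbit_update_iff hl hv hi
  generalize hj : Function.update l t₀ v = j at hkey hi hjl
  -- It suffices to count in column l: invariance under simultaneous permutation carries the result
  -- to the columns l ∘ π, and all other columns are zero on both sides.
  have hcol : ∀ p, (xiEnd K i j * xiEnd K j l) p l =
      ((Finset.univ.filter fun t => l t = l t₀ ∧ i t = i t₀).card : K) * xiEnd K i l p l := by
    intro p
    have hsum : (xiEnd K i j * xiEnd K j l) p l =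
        ∑ k, if SameOrbit i l p l ∧ ∃ t, l t = l t₀ ∧ p t = i t₀ ∧ k = Function.update l t v
          then (1 : K) else 0 := by
      rw [Matrix.mul_apply]
      refine Finset.sum_congr rfl fun k _ => ?_
      simp only [← hkey, xiEnd, Matrix.of_apply, ite_and, mul_ite, mul_one, mul_zero]
      split_ifs <;> rfl
    rw [hsum]
    by_cases h : SameOrbit i l p l
    · rw [xiEnd_apply_of_sameOrbit h, mul_one]
      obtain ⟨π, rfl, hlπ⟩ := h
      have hO : SameOrbit i l (i ∘ π) l := ⟨π, rfl, hlπ⟩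
      simp only [hO, true_and]
      rw [Finset.sum_boole]
      congr 1
      -- Here p = i ∘ π, so places of p correspond to places of i through π. Distinct t give
      -- distinct k because v ≠ l t₀.
      refine (Finset.card_bij (fun t _ => Function.update l (π⁻¹ t) v) ?_ ?_ ?_).symm
      · intro t ht
        simp only [Finset.mem_filter, Finset.mem_univ, true_and] at ht ⊢
        refine ⟨π⁻¹ t, ?_, by simpa using ht.2, rfl⟩
        rw [congrFun hlπ (π⁻¹ t)]
        simpa using ht.1
      · intro s hs t ht hst
        simp only [Finset.mem_filter, Finset.mem_univ, true_and] at hs ht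
        by_contra hne
        have hlt : l (π⁻¹ s) = l t₀ := by
          rw [congrFun hlπ (π⁻¹ s)]
          simpa using hs.1
        have := congrFun hst (π⁻¹ s)
        rw [Function.update_self, Function.update_of_ne fun h => hne (π⁻¹.injective h), hlt] at this
        exact hv.ne this
      · intro k hk
        simp only [Finset.mem_filter, Finset.mem_univ, true_and] at hk
        obtain ⟨t, h1, h2, rfl⟩ := hk
        refine ⟨π t, ?_, by simp⟩
        simp only [Finset.mem_filter, Finset.mem_univ, true_and]
        exact ⟨(congrFun hlπ t).symm.trans h1, h2⟩
    · rw [xiEnd_apply_of_not_sameOrbit h, mul_zero]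
      simp [h]
  have hmem : xiEnd K i j * xiEnd K j l ∈ borelSchur K n r :=
    mul_mem (xiEnd_mem hi) (xiEnd_mem hjl)
  ext p q
  rw [Matrix.smul_apply, smul_eq_mul]
  by_cases hq : ∃ π : Equiv.Perm (Fin r), q = l ∘ π
  · obtain ⟨π, rfl⟩ := hq
    have hp : p = (p ∘ ⇑π⁻¹) ∘ π := funext fun s => by simp
    rw [hp, apply_comp_perm_of_mem hmem, apply_comp_perm_of_mem (xiEnd_mem (hi.trans hjl)), hcol]
  · have h0 : ∀ i' p', xiEnd K i' l p' q = 0 := fun i' p' =>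
      xiEnd_apply_of_not_sameOrbit fun ⟨π, _, h⟩ => hq ⟨π, h⟩
    rw [Matrix.mul_apply, h0, mul_zero]
    exact Finset.sum_eq_zero fun k _ => by rw [h0, mul_zero]

/-- If `λ` is supported at the places `0` and `ν + 1` and `1, …, λ_{ν+1}` are invertible in `K`,
then `ξ_{l(λ(ν,1)),l(λ)}` generates the radical of `S ξ_λ`. -/
theorem exists_mul_xiIdem_eq_of_support (lam : Weight n r) (ν : Fin (n - 1))
    (hm : 1 ≤ lam.1 ⟨ν + 1, by omega⟩)
    (hsupp : ∀ (k : ℕ) (hk : k + 1 < n), k ≠ ν → lam.1 ⟨k + 1, hk⟩ = 0)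
    (hinv : ∀ N : ℕ, 1 ≤ N → N ≤ lam.1 ⟨ν + 1, by omega⟩ → (N : K) ≠ 0) (a : Alg K n r) :
    ∃ b, a * xiIdem K lam = character K lam a • xiIdem K lam +
      b * xi K (lam.move ν 1 hm).l lam.l (lam.move_l_le ν 1 hm) := by
  classical
  obtain ⟨t₀, ht₀, hj⟩ := lam.exists_move_one_l_eq_update ν hm
  have hl : ∀ s, (lam.l s : ℕ) = 0 ∨ lam.l s = lam.l t₀ := by
    intro s
    by_contra! h
    obtain ⟨k, hk⟩ := Nat.exists_eq_succ_of_ne_zero h.1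
    have hkn : k + 1 < n := by have := (lam.l s).2; omega
    have hs : lam.l s = ⟨k + 1, hkn⟩ := Fin.ext hk
    have h1 := (lam.l_eq_succ_iff s k hkn).mp hs
    rw [hsupp k hkn] at h1
    · omega
    · rintro rfl
      exact h.2 (hs.trans ht₀.symm)
  have hv : (⟨ν, by omega⟩ : Fin n) < lam.l t₀ := by
    rw [ht₀, Fin.lt_def]
    exact Nat.lt_succ_self _
  let e := xi K (lam.move ν 1 hm).l lam.l (lam.move_l_le ν 1 hm)
  let T : Submodule K (Alg K n r) :=
    { carrier := {a | ∃ b, a * xiIdem K lam = character K lam a • xiIdem K lam + b * e}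
      zero_mem' := ⟨0, by simp⟩
      add_mem' := by
        rintro a a' ⟨b, hb⟩ ⟨b', hb'⟩
        exact ⟨b + b', by rw [add_mul, hb, hb', map_add, add_smul, add_mul]; abel⟩
      smul_mem' := by
        rintro c a ⟨b, hb⟩
        exact ⟨c • b, by
          rw [smul_mul_assoc, hb, character_smul, smul_add, smul_smul, smul_mul_assoc]⟩ }
  suffices hT : T = ⊤ from (hT ▸ Submodule.mem_top : a ∈ T)
  rw [eq_top_iff, ← span_xi_eq_top, Submodule.span_le]
  rintro _ ⟨i, k, hik, rfl⟩
  change ∃ b, _ = _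
  by_cases hk : SameOrbit lam.l lam.l k k
  swap
  · refine ⟨0, ?_⟩
    rw [xi_mul_xiIdem_of_not_sameOrbit hik lam hk, zero_mul, add_zero]
    have : character K lam (xi K i k hik) = 0 :=
      xiEnd_apply_of_not_sameOrbit fun ⟨π, _, h⟩ =>
        hk ⟨π⁻¹, funext fun s => by simp [h], funext fun s => by simp [h]⟩
    rw [this, zero_smul]
  obtain ⟨π, rfl, -⟩ := hk
  obtain ⟨i, rfl⟩ : ∃ i', i = i' ∘ π := ⟨i ∘ ⇑π⁻¹, funext fun s => by simp⟩
  have hil : i ≤ lam.l := fun s => by simpa using hik (π⁻¹ s)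
  rw [show xi K (i ∘ π) (lam.l ∘ π) hik = xi K i lam.l hil from
    Subtype.ext (xiEnd_comp_perm i lam.l π), xi_mul_xiIdem]
  by_cases hne : i = lam.l
  · subst hne
    exact ⟨0, by rw [zero_mul, add_zero, show xi K lam.l lam.l hil = xiIdem K lam from rfl,
      character_xiIdem, one_smul]⟩
  rw [character_xi_of_ne hil hne]
  obtain ⟨s, hs⟩ : ∃ s, i s < lam.l s := by
    by_contra! hc
    exact hne (le_antisymm hil hc)
  have hls : lam.l s = lam.l t₀ := (hl s).resolve_left fun h => by
    rw [Fin.lt_def] at hs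
    omega
  -- Interchanging s and t₀ fixes l(λ), so the strict inequality i s < l s may be moved to t₀. There
  -- it becomes i' t₀ ≤ ν, which gives i' ≤ j.
  have hswap : lam.l = lam.l ∘ Equiv.swap s t₀ := by
    funext u
    simp only [Function.comp_apply, Equiv.swap_apply_def]
    split_ifs with h1 h2
    · rw [h1, hls]
    · rw [h2, hls]
    · rfl
  set i' := i ∘ Equiv.swap s t₀ with hi'
  have hi't : i' t₀ = i s := by simp [hi']
  have hi'l : i' ≤ lam.l := fun u => by
    rw [hswap]
    exact hil _
  have hi'j : i' ≤ Function.update lam.l t₀ ⟨ν, by omega⟩ := by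
    intro u
    by_cases hu : u = t₀
    · rw [hu, Function.update_self, hi't, Fin.le_def]
      rw [hls, ht₀, Fin.lt_def] at hs
      exact Nat.le_of_lt_succ hs
    · rw [Function.update_of_ne hu]
      exact hi'l u
  have hmul := xiEnd_mul_xiEnd_update (K := K) hl hv hi'j
  set N := (Finset.univ.filter fun t => lam.l t = lam.l t₀ ∧ i' t = i' t₀).card with hNdef
  have hN : (N : K) ≠ 0 := by
    refine hinv N (Finset.card_pos.mpr ⟨t₀, by simp⟩) ?_
    refine le_trans (Finset.card_le_card fun t ht => ?_) (lam.card_l_eq_succ_le ν (by omega))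
    simp only [Finset.mem_filter, Finset.mem_univ, true_and] at ht ⊢
    exact ht.1.trans ht₀
  refine ⟨(N : K)⁻¹ • xi K i' (lam.move ν 1 hm).l (hj ▸ hi'j), ?_⟩
  rw [zero_smul, zero_add]
  refine Alg.val_injective K n r ?_
  rw [map_mul, map_smul, val_xi, val_xi, val_xi, smul_mul_assoc, hj, hmul, smul_smul,
    inv_mul_cancel₀ hN, one_smul, ← xiEnd_comp_perm i lam.l (Equiv.swap s t₀), ← hswap]

/-- Uniqueness of the index supplies the arithmetic conditions: a nonzero λ_{k+1} with k ≠ ν would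
give the index (k, 1), and λ_{ν+1} ≥ p would give (ν, p). -/
theorem exists_mul_xiIdem_eq {lam : Weight n r} {x₀ : StepIndex K lam} (h₀ : ∀ x, x = x₀)
    (a : Alg K n r) :
    ∃ b, a * xiIdem K lam = character K lam a • xiIdem K lam +
      b * xi K (x₀.weight K).l lam.l x₀.weight_l_le := by
  obtain ⟨ν, hm, hx⟩ := StepIndex.exists_eq_of_unique h₀
  rw [hx] at h₀ ⊢
  refine exists_mul_xiIdem_eq_of_support lam ν hm ?_ ?_ a
  · intro k hk hkν
    by_contra hc
    have := h₀ ⟨(⟨k, by omega⟩, 1), StepIndex.one_property lam ⟨k, by omega⟩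
      (Nat.one_le_iff_ne_zero.mpr hc)⟩
    exact hkν (congrArg (fun x : StepIndex K lam => (x.1.1 : ℕ)) this)
  · intro N h1 hN hN0
    have hdvd := (ringChar.spec K N).mp hN0
    have hK : ringChar K ≠ 0 := fun h => by
      rw [h, zero_dvd_iff] at hdvd
      omega
    have hle := (Nat.le_of_dvd h1 hdvd).trans hN
    have := h₀ ⟨(ν, ringChar K), hle, by rw [if_neg hK]; exact ⟨1, (pow_one _).symm⟩⟩
    exact CharP.ringChar_ne_one (congrArg (fun x : StepIndex K lam => x.1.2) this)

/-- `ξ_{l(λ(ν,m)),l(λ)}` is not annihilated by elements outside the radical. -/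
theorem character_eq_zero_of_xi_mul_eq_zero {lam : Weight n r} {j : Fin r → Fin n}
    (hj : j ≤ lam.l) {a : Alg K n r} (h : xi K j lam.l hj * a = 0) : character K lam a = 0 := by
  -- In the (j, l(λ)) entry of the product, a summand needs k in the orbit of l(λ) and k ≤ l(λ).
  -- Only k = l(λ) remains, and its contribution is the character of a.
  have h' := congrFun (congrFun (congrArg (Alg.val K n r) h) j) lam.l
  rw [map_mul, map_zero, val_xi, Matrix.mul_apply, Finset.sum_eq_single lam.l] at h'
  · rwa [xiEnd_apply_of_sameOrbit (.refl _ _), one_mul] at h'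
  · intro k _ hk
    by_cases hO : SameOrbit j lam.l j k
    · rw [apply_eq_zero_of_mem (Alg.val_mem K n r a), mul_zero]
      intro hle
      obtain ⟨π, -, hπ⟩ := hO
      exact hk (eq_of_le_of_comp_perm hle hπ)
    · rw [xiEnd_apply_of_not_sameOrbit hO, zero_mul]
  · simp

end Radical

end BorelSchur

/-! ## Modules with an essential simple socle -/

section Essential

variable (A : Type*) [Ring A] (M : Type*) [AddCommGroup M] [Module A M]

/-- A module has a socle element if some nonzero element lies in every nonzero submodule. -/
def HasSocleElement : Prop := ∃ e : M, e ≠ 0 ∧ ∀ m : M, m ≠ 0 → ∃ a : A, a • m = e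

variable {A M}

theorem HasSocleElement.of_injective (h : HasSocleElement A M) {N : Type*} [AddCommGroup N]
    [Module A N] [Nontrivial N] (f : N →ₗ[A] M) (hf : Function.Injective f) :
    HasSocleElement A N := by
  obtain ⟨e, he, h⟩ := h
  have hne : ∀ x, x ≠ 0 → f x ≠ 0 := fun x hx h0 => hx (hf (h0.trans (map_zero f).symm))
  obtain ⟨x, hx⟩ := exists_ne (0 : N)
  obtain ⟨a, ha⟩ := h _ (hne x hx)
  refine ⟨a • x, fun h0 => he ?_, fun y hy => ?_⟩
  · rw [← ha, ← map_smul, h0, map_zero]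
  · obtain ⟨b, hb⟩ := h _ (hne y hy)
    exact ⟨b, hf (by rw [map_smul, map_smul, hb, ha])⟩

theorem exists_smul_mem_of_ne_bot {e : M} (h : ∀ m : M, m ≠ 0 → ∃ a : A, a • m = e)
    {p : Submodule A M} (hp : p ≠ ⊥) : e ∈ p := by
  obtain ⟨x, hx, hx0⟩ := p.ne_bot_iff.mp hp
  obtain ⟨a, ha⟩ := h x hx0
  exact ha ▸ p.smul_mem a hx

theorem HasSocleElement.isIndecomposable (h : HasSocleElement A M) : IsIndecomposable A M := by
  obtain ⟨e, he, h⟩ := h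
  refine ⟨⟨e, 0, he⟩, fun p q hpq => ?_⟩
  by_contra! hc
  exact he (Submodule.disjoint_def.mp hpq.disjoint e (exists_smul_mem_of_ne_bot h hc.1)
    (exists_smul_mem_of_ne_bot h hc.2))

/-- The span of e is the least nonzero submodule, hence the only simple one. -/
theorem HasSocleElement.isSimpleModule_socle (h : HasSocleElement A M) :
    IsSimpleModule A (moduleSocle A M) := by
  obtain ⟨e, he, h⟩ := h
  have hatom : IsAtom (Submodule.span A {e}) := by
    refine ⟨fun h0 => he (Submodule.span_singleton_eq_bot.mp h0), fun p hp => ?_⟩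
    by_contra hc
    exact hp.not_ge ((Submodule.span_singleton_le_iff_mem e p).mpr
      (exists_smul_mem_of_ne_bot h hc))
  have hsoc : moduleSocle A M = Submodule.span A {e} := by
    refine le_antisymm (sSup_le fun p hp => ?_) (le_sSup (isSimpleModule_iff_isAtom.mpr hatom))
    have hp' : IsAtom p := isSimpleModule_iff_isAtom.mp hp
    have hle := (Submodule.span_singleton_le_iff_mem e p).mpr
      (exists_smul_mem_of_ne_bot h hp'.1)
    exact ((hp'.le_iff.mp hle).resolve_left hatom.1).ge
  rw [hsoc]
  exact isSimpleModule_iff_isAtom.mpr hatom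

/-- A split epimorphism from an indecomposable module onto a nonzero module is bijective. -/
theorem IsIndecomposable.bijective_of_comp_eq_id (hM : IsIndecomposable A M) {N : Type*}
    [AddCommGroup N] [Module A N] [Nontrivial N] {g : M →ₗ[A] N} {s : N →ₗ[A] M}
    (hs : g ∘ₗ s = LinearMap.id) : Function.Bijective g := by
  have hgs : ∀ x, g (s x) = x := fun x => LinearMap.congr_fun hs x
  have hc : IsCompl (LinearMap.ker g) (LinearMap.range s) := by
    refine ⟨Submodule.disjoint_def.mpr ?_, codisjoint_iff_le_sup.mpr fun x _ => ?_⟩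
    · rintro _ hx ⟨y, rfl⟩
      rw [LinearMap.mem_ker, hgs] at hx
      rw [hx, map_zero]
    · refine Submodule.mem_sup.mpr ⟨x - s (g x), ?_, s (g x), ⟨_, rfl⟩, sub_add_cancel _ _⟩
      rw [LinearMap.mem_ker, map_sub, hgs, sub_self]
  refine ⟨?_, fun x => ⟨s x, hgs x⟩⟩
  rcases hM.2 _ _ hc with h | h
  · exact LinearMap.ker_eq_bot.mp h
  · obtain ⟨y, hy⟩ := exists_ne (0 : N)
    refine absurd ?_ hy
    rw [← hgs y, LinearMap.range_eq_bot.mp h, LinearMap.zero_apply, map_zero]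

/-- A linear functional vanishing on the kernel of a linear map factors through that map. -/
theorem LinearMap.exists_comp_eq_of_ker_le {k V W : Type*} [Field k] [AddCommGroup V] [Module k V]
    [AddCommGroup W] [Module k W] (u : V →ₗ[k] W) (g : V →ₗ[k] k)
    (h : LinearMap.ker u ≤ LinearMap.ker g) : ∃ f : W →ₗ[k] k, f ∘ₗ u = g := by
  have hg : g ∈ (LinearMap.ker u).dualAnnihilator :=
    (Submodule.mem_dualAnnihilator g).mpr fun w hw => h hw
  rw [← LinearMap.range_dualMap_eq_dualAnnihilator_ker] at hg
  exact hg

end Essential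

/-! ## Evaluating elements of the Nakayama module -/

section NakayamaEval

variable {K : Type*} [Field K] {A : Type*} [Ring A] [Algebra K A]
  {P Q : Type*} [AddCommGroup P] [Module A P] [AddCommGroup Q] [Module A Q]

/-- An element of the Nakayama module as a linear functional on `Hom_A(P, A)`. -/
def Nakayama.functional (z : Nakayama K A P) : (P →ₗ[A] A) →ₗ[K] K := z

/-- A linear functional on `Hom_A(P, A)` as an element of the Nakayama module. -/
def Nakayama.ofFunctional (z : (P →ₗ[A] A) →ₗ[K] K) : Nakayama K A P := z

theorem Nakayama.ext {z w : Nakayama K A P} (h : ∀ φ, z.functional φ = w.functional φ) : z = w :=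
  LinearMap.ext h

theorem Nakayama.functional_smul (a : A) (z : Nakayama K A P) (φ : P →ₗ[A] A) :
    (a • z).functional φ = z.functional (homMulRight K A P a φ) := rfl

theorem Nakayama.functional_map (f : P →ₗ[A] Q) (z : Nakayama K A P) (φ : Q →ₗ[A] A) :
    (Nakayama.map K A f z).functional φ = z.functional (φ ∘ₗ f) := rfl

variable (K A P) in
theorem Nakayama.finite [Module.Finite K A] [Module.Finite A P] :
    Module.Finite A (Nakayama K A P) := by
  let : Module K (Nakayama K A P) := inferInstanceAs (Module K ((P →ₗ[A] A) →ₗ[K] K))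
  have : IsScalarTower K A (Nakayama K A P) := ⟨fun c a z => by
    refine Nakayama.ext fun φ => ?_
    have : homMulRight K A P (c • a) φ = c • homMulRight K A P a φ := by
      ext x
      exact mul_smul_comm c (φ x) a
    rw [Nakayama.functional_smul, this, map_smul]
    rfl⟩
  have : Module.Finite K (P →ₗ[A] A) := by
    obtain ⟨s, hs⟩ := Module.Finite.fg_top (R := A) (M := P)
    -- Homomorphisms are determined by their values on a finite generating set, so Hom_A(P, A) is
    -- finite-dimensional over K.
    let ev : (P →ₗ[A] A) →ₗ[K] (s → A) :=
      { toFun := fun φ x => φ x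
        map_add' := fun _ _ => rfl
        map_smul' := fun _ _ => rfl }
    refine Module.Finite.of_injective ev fun φ ψ h => LinearMap.ext_on hs fun x hx => ?_
    exact congrFun h ⟨x, hx⟩
  have : Module.Finite K (Nakayama K A P) :=
    inferInstanceAs (Module.Finite K ((P →ₗ[A] A) →ₗ[K] K))
  exact Module.Finite.of_restrictScalars_finite K A _

end NakayamaEval

namespace BorelSchur

/-! ## The presentation of `K_λ` -/

section Presentation

variable {K : Type u} [Field K] {n r : ℕ}

/-- The underlying scalar of an element of `K_λ`. -/
def Simple.val {lam : Weight n r} : Simple K lam →+ K := AddMonoidHom.id K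

theorem Simple.val_injective {lam : Weight n r} :
    Function.Injective (Simple.val : Simple K lam →+ K) := fun _ _ h => h

theorem Simple.val_smul {lam : Weight n r} (a : Alg K n r) (c : Simple K lam) :
    (a • c).val = character K lam a * c.val := rfl

instance (lam : Weight n r) : Nontrivial (Simple K lam) := inferInstanceAs (Nontrivial K)

theorem Simple.exists_smul_eq {lam : Weight n r} {c : Simple K lam} (hc : c ≠ 0)
    (d : Simple K lam) : ∃ a : Alg K n r, a • c = d := by
  have hc' : c.val ≠ 0 := fun h => hc (Simple.val_injective (h.trans (map_zero _).symm))
  refine ⟨algebraMap K _ (d.val * (c.val)⁻¹), Simple.val_injective ?_⟩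
  rw [Simple.val_smul, character_algebraMap, inv_mul_cancel_right₀ hc']

theorem Simple.hasSocleElement (lam : Weight n r) :
    HasSocleElement (Alg K n r) (Simple K lam) := by
  obtain ⟨e, he⟩ := exists_ne (0 : Simple K lam)
  exact ⟨e, he, fun m hm => Simple.exists_smul_eq hm e⟩

instance (lam : Weight n r) : Module.Finite (Alg K n r) (Simple K lam) := by
  obtain ⟨e, he⟩ := exists_ne (0 : Simple K lam)
  refine ⟨⟨{e}, eq_top_iff.mpr fun d _ => ?_⟩⟩
  rw [Finset.coe_singleton]
  exact Submodule.mem_span_singleton.mpr (Simple.exists_smul_eq he d)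

instance : Module.Finite K (Alg K n r) := inferInstanceAs (Module.Finite K (borelSchur K n r))

variable [Infinite K]

theorem Proj.val_mul_xiIdem {lam : Weight n r} (y : Proj K lam) : y.1 * xiIdem K lam = y.1 := by
  obtain ⟨a, ha⟩ := Submodule.mem_span_singleton.mp y.2
  rw [← ha, smul_eq_mul, mul_assoc, xiIdem_mul_self]

theorem Proj.eq_smul_gen {lam : Weight n r} (y : Proj K lam) : y = y.1 • Proj.gen K lam :=
  Subtype.ext y.val_mul_xiIdem.symm

theorem Proj.xiIdem_smul_gen (lam : Weight n r) :
    xiIdem K lam • Proj.gen K lam = Proj.gen K lam := Subtype.ext (xiIdem_mul_self lam)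

theorem Proj.gen_ne_zero (lam : Weight n r) : Proj.gen K lam ≠ 0 := fun h =>
  xiIdem_ne_zero lam (congrArg Subtype.val h)

theorem functional_theta (lam : Weight n r) (c : Simple K lam)
    (φ : Proj K lam →ₗ[Alg K n r] Alg K n r) :
    (theta K lam c).functional φ = character K lam (φ (Proj.gen K lam)) * c.val := rfl

theorem theta_injective (lam : Weight n r) : Function.Injective (theta K lam) := by
  refine (injective_iff_map_eq_zero _).mpr fun c hc => Simple.val_injective ?_
  have h : (theta K lam c).functional (Submodule.subtype _) = 0 := by rw [hc]; rfl
  rw [functional_theta] at h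
  have h1 : character K lam (Submodule.subtype _ (Proj.gen K lam)) = 1 := character_xiIdem lam
  rw [h1, one_mul] at h
  rw [h, map_zero]

instance (lam : Weight n r) : Module.Finite (Alg K n r) (Proj K lam) :=
  Module.Finite.span_singleton _ _

/-- If `P₁` is indecomposable, it has exactly one summand. -/
theorem exists_forall_eq_of_isIndecomposable_P1 {lam : Weight n r}
    (h : IsIndecomposable (Alg K n r) (P1 K lam)) : ∃ x₀ : StepIndex K lam, ∀ x, x = x₀ := by
  classical
  have hne : Nonempty (StepIndex K lam) := by
    by_contra hc
    rw [not_nonempty_iff] at hc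
    exact not_subsingleton_iff_nontrivial.mpr h.1 inferInstance
  obtain ⟨x₀⟩ := hne
  refine ⟨x₀, ?_⟩
  by_contra! hx
  obtain ⟨x, hx⟩ := hx
  -- Projection to the summand x₀ is a split epimorphism, hence bijective by indecomposability, yet
  -- it kills the generator of any other summand.
  let g : P1 K lam →ₗ[Alg K n r] Proj K (x₀.weight K) := LinearMap.proj x₀
  let s := LinearMap.single (Alg K n r) (fun x : StepIndex K lam => Proj K (x.weight K)) x₀
  have hs : g ∘ₗ s = LinearMap.id := LinearMap.proj_comp_single_same _ _ _
  have : Nontrivial (Proj K (x₀.weight K)) := ⟨_, 0, Proj.gen_ne_zero _⟩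
  have hinj := (h.bijective_of_comp_eq_id hs).1
  have h0 : (Pi.single x (Proj.gen K (x.weight K)) : P1 K lam) = 0 := by
    refine hinj ?_
    rw [map_zero]
    exact Pi.single_eq_of_ne (Ne.symm hx) _
  have hx0 := congrFun h0 x
  rw [Pi.single_eq_same] at hx0
  exact Proj.gen_ne_zero _ hx0

/-- The tuple of the generators of the summands of `P₁`. -/
noncomputable def P1.gen (lam : Weight n r) : P1 K lam := fun x => Proj.gen K (x.weight K)

variable {lam : Weight n r} {x₀ : StepIndex K lam}

theorem P1.eq_smul_gen (h₀ : ∀ x, x = x₀) (y : P1 K lam) : y = (y x₀).1 • P1.gen lam := by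
  funext x
  rw [h₀ x]
  exact (y x₀).eq_smul_gen

theorem P1.xiIdem_smul_gen (h₀ : ∀ x, x = x₀) :
    xiIdem K (x₀.weight K) • P1.gen (K := K) lam = P1.gen lam := by
  funext x
  rw [h₀ x]
  exact Proj.xiIdem_smul_gen _

theorem P1.hom_ext (h₀ : ∀ x, x = x₀) {M : Type*} [AddCommGroup M] [Module (Alg K n r) M]
    {f g : P1 K lam →ₗ[Alg K n r] M} (h : f (P1.gen lam) = g (P1.gen lam)) : f = g := by
  refine LinearMap.ext fun y => ?_
  rw [P1.eq_smul_gen h₀ y, map_smul, map_smul, h]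

theorem p1_gen (h₀ : ∀ x, x = x₀) : p1 K lam (P1.gen lam) =
    xi K (x₀.weight K).l lam.l x₀.weight_l_le • Proj.gen K lam := by
  have h : p1 K lam (P1.gen lam) = p1Component K x₀ (Proj.gen K (x₀.weight K)) := by
    rw [p1, LinearMap.sum_apply, Finset.sum_eq_single x₀]
    · rfl
    · exact fun x _ hx => absurd (h₀ x) hx
    · exact fun hx => absurd (Finset.mem_univ _) hx
  rw [h]
  refine Subtype.ext ?_
  exact (xiIdem_mul_xi x₀.weight_l_le).trans (xi_mul_xiIdem x₀.weight_l_le).symm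

theorem xiIdem_mul_apply_gen (h₀ : ∀ x, x = x₀) (φ : P1 K lam →ₗ[Alg K n r] Alg K n r) :
    xiIdem K (x₀.weight K) * φ (P1.gen lam) = φ (P1.gen lam) := by
  rw [← smul_eq_mul, ← map_smul, P1.xiIdem_smul_gen h₀]

/-- Right multiplication by η on the summand x₀. When x₀ is the only index, evaluation at the
generator thus identifies Hom(P₁, S) with ξ_μ S. -/
theorem exists_hom_P1_apply_gen (x₀ : StepIndex K lam) (η : Alg K n r) :
    ∃ φ : P1 K lam →ₗ[Alg K n r] Alg K n r, φ (P1.gen lam) = xiIdem K (x₀.weight K) * η :=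
  ⟨LinearMap.toSpanSingleton _ _ η ∘ₗ Submodule.subtype _ ∘ₗ LinearMap.proj x₀, rfl⟩

/-- The functional `φ ↦ φ(gen)_μ` on `Hom(P₁, S)` spans the socle of `D P₁ᵗ`. -/
theorem exists_socle_functional (h₀ : ∀ x, x = x₀) :
    ∃ e : Nakayama K (Alg K n r) (P1 K lam), e ≠ 0 ∧
    (∀ φ, e.functional φ = character K (x₀.weight K) (φ (P1.gen lam))) ∧
    ∀ z : Nakayama K (Alg K n r) (P1 K lam), z ≠ 0 → ∃ a : Alg K n r, a • z = e := by
  let e : Nakayama K (Alg K n r) (P1 K lam) := Nakayama.ofFunctional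
    { toFun := fun φ => character K (x₀.weight K) (φ (P1.gen lam))
      map_add' := fun φ ψ => map_add _ _ _
      map_smul' := fun c φ => character_smul _ _ _ }
  have he : ∀ φ, e.functional φ = character K (x₀.weight K) (φ (P1.gen lam)) := fun _ => rfl
  refine ⟨e, fun h => ?_, he, fun z hz => ?_⟩
  · obtain ⟨φ, hφ⟩ := exists_hom_P1_apply_gen x₀ (1 : Alg K n r)
    have h1 := he φ
    rw [hφ, mul_one, character_xiIdem, h] at h1
    exact zero_ne_one h1
  · obtain ⟨ψ, hψ⟩ : ∃ ψ, z.functional ψ ≠ 0 := by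
      by_contra! hc
      exact hz (Nakayama.ext hc)
    -- With a = z(ψ)⁻¹ ψ(gen), the relation ξ_μ S ξ_μ = K ξ_μ turns φ · a into a scalar multiple of
    -- ψ; the scalar is the ξ_μ-coefficient of φ(gen), divided by z(ψ).
    refine ⟨(z.functional ψ)⁻¹ • ψ (P1.gen lam), Nakayama.ext fun φ => ?_⟩
    have hφ : homMulRight K (Alg K n r) _ ((z.functional ψ)⁻¹ • ψ (P1.gen lam)) φ =
        (character K (x₀.weight K) (φ (P1.gen lam)) * (z.functional ψ)⁻¹) • ψ := by
      refine P1.hom_ext h₀ ?_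
      change φ (P1.gen lam) * ((z.functional ψ)⁻¹ • ψ (P1.gen lam)) =
        (character K (x₀.weight K) (φ (P1.gen lam)) * (z.functional ψ)⁻¹) • ψ (P1.gen lam)
      rw [← xiIdem_mul_apply_gen h₀ ψ, mul_smul_comm, ← mul_assoc,
        ← xiIdem_mul_apply_gen h₀ φ, xiIdem_mul_mul_xiIdem, smul_mul_assoc, smul_smul, mul_comm,
        xiIdem_mul_apply_gen h₀ φ]
    rw [Nakayama.functional_smul, hφ, map_smul, he, smul_eq_mul, inv_mul_cancel_right₀ hψ]

theorem hasSocleElement_nakayama_P1 (h₀ : ∀ x, x = x₀) :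
    HasSocleElement (Alg K n r) (Nakayama K (Alg K n r) (P1 K lam)) := by
  obtain ⟨e, he, -, h⟩ := exists_socle_functional h₀
  exact ⟨e, he, h⟩

theorem apply_p1_gen (h₀ : ∀ x, x = x₀) (φ : Proj K lam →ₗ[Alg K n r] Alg K n r) :
    φ (p1 K lam (P1.gen lam)) =
      xi K (x₀.weight K).l lam.l x₀.weight_l_le * φ (Proj.gen K lam) := by
  rw [p1_gen h₀, map_smul, smul_eq_mul]

end Presentation

/-! ## The Auslander–Reiten sequence -/

section Sequence

variable {K : Type u} [Field K] [Infinite K] {n r : ℕ} {lam : Weight n r}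

instance : Module.Finite (Alg K n r) (Nakayama K (Alg K n r) (P1 K lam)) :=
  Nakayama.finite K _ _

instance : IsNoetherianRing (Alg K n r) := IsNoetherianRing.of_finite K _

theorem mem_middle_iff (z : Nakayama K (Alg K n r) (P1 K lam)) (c : Simple K lam) :
    (z, c) ∈ middle K lam ↔ ∀ φ : Proj K lam →ₗ[Alg K n r] Alg K n r,
      z.functional (φ ∘ₗ p1 K lam) = character K lam (φ (Proj.gen K lam)) * c.val :=
  ⟨fun h φ => congrArg (fun w => Nakayama.functional w φ) h, fun h => Nakayama.ext h⟩

/-- The projection of the middle term to `D P₁ᵗ`. -/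
noncomputable def middleFst (lam : Weight n r) :
    middle K lam →ₗ[Alg K n r] Nakayama K (Alg K n r) (P1 K lam) :=
  LinearMap.fst _ _ _ ∘ₗ (middle K lam).subtype

theorem middleFst_injective : Function.Injective (middleFst (K := K) lam) := by
  refine (injective_iff_map_eq_zero _).mpr ?_
  rintro ⟨⟨z, c⟩, h⟩ (rfl : z = 0)
  have hc : theta K lam c = theta K lam 0 := by
    rw [map_zero, ← map_zero (Nakayama.map K (Alg K n r) (p1 K lam))]
    exact h.symm
  exact Subtype.ext (Prod.ext rfl (theta_injective lam hc))

theorem middleInl_injective : Function.Injective (middleInl K lam) := fun _ _ h =>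
  Subtype.ext (congrArg (fun y : middle K lam => y.1.1) h)

theorem exact_middleInl_middleSnd : Function.Exact (middleInl K lam) (middleSnd K lam) := by
  rintro ⟨⟨z, c⟩, h⟩
  constructor
  · rintro (rfl : c = 0)
    refine ⟨⟨z, ?_⟩, rfl⟩
    have h' : Nakayama.map K (Alg K n r) (p1 K lam) z = theta K lam 0 := h
    rwa [map_zero] at h'
  · rintro ⟨w, hw⟩
    exact (congrArg (fun y : middle K lam => y.1.2) hw).symm

variable {x₀ : StepIndex K lam}

/-- A preimage of c amounts to extending θ(c) along φ ↦ φ ∘ p₁. This is possible because ξ φ(gen) =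
0 forces the character of φ(gen) at λ to vanish. -/
theorem middleSnd_surjective (h₀ : ∀ x, x = x₀) : Function.Surjective (middleSnd K lam) := by
  intro c
  obtain ⟨z, hz⟩ := LinearMap.exists_comp_eq_of_ker_le (LinearMap.lcomp K (Alg K n r) (p1 K lam))
    (theta K lam c).functional fun φ hφ => by
      rw [LinearMap.mem_ker] at hφ ⊢
      have h := apply_p1_gen h₀ φ
      rw [show φ (p1 K lam (P1.gen lam)) = 0 from LinearMap.congr_fun hφ _] at h
      rw [functional_theta, character_eq_zero_of_xi_mul_eq_zero _ h.symm, zero_mul]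
  exact ⟨⟨(Nakayama.ofFunctional z, c), (mem_middle_iff _ _).mpr fun φ =>
    LinearMap.congr_fun hz φ⟩, rfl⟩

/-- A section would embed K_λ in D P₁ᵗ, so its image would contain the socle element e. But ξ_μ
fixes e and kills K_λ, because μ ≠ λ. -/
theorem not_split_middleSnd (h₀ : ∀ x, x = x₀) :
    ¬ ∃ s : Simple K lam →ₗ[Alg K n r] middle K lam, middleSnd K lam ∘ₗ s = LinearMap.id := by
  rintro ⟨s, hs⟩
  obtain ⟨c, hc⟩ := exists_ne (0 : Simple K lam)
  have hinj : Function.Injective s := Function.LeftInverse.injective (g := middleSnd K lam)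
    fun x => LinearMap.congr_fun hs x
  obtain ⟨e, he, hφ, hsoc⟩ := exists_socle_functional h₀
  have hz : middleFst lam (s c) ≠ 0 := fun h => hc (hinj (middleFst_injective
    (by rw [h, map_zero, map_zero])))
  obtain ⟨a, ha⟩ := hsoc _ hz
  rw [← map_smul, ← map_smul] at ha
  have hact : ∀ d : Simple K lam, xiIdem K (x₀.weight K) • d = 0 := fun d => by
    refine Simple.val_injective ?_
    have h0 : character K lam (xiIdem K (x₀.weight K)) = 0 := by
      refine xiEnd_apply_of_not_sameOrbit ?_
      rintro ⟨π, h, -⟩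
      exact StepIndex.weight_l_ne h₀ (eq_of_le_of_comp_perm x₀.weight_l_le (π := π⁻¹)
        (funext fun t => by simp [h]))
    rw [Simple.val_smul, h0, zero_mul, map_zero]
  refine he ?_
  have h1 : xiIdem K (x₀.weight K) • e = e := by
    refine Nakayama.ext fun φ => ?_
    rw [Nakayama.functional_smul, hφ, hφ]
    change character K _ (φ (P1.gen lam) * xiIdem K (x₀.weight K)) = _
    rw [map_mul, character_xiIdem, mul_one]
  rw [← h1, ← ha, ← map_smul, ← map_smul, hact, map_zero, map_zero]

/-- The socle element e lies in τK_λ: it reads a diagonal coefficient, and every φ(p₁(gen)) is a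
multiple of the off-diagonal ξ. -/
theorem nontrivial_tau (h₀ : ∀ x, x = x₀) : Nontrivial (tau K lam) := by
  obtain ⟨e, he, hφ, -⟩ := exists_socle_functional h₀
  refine ⟨⟨e, Nakayama.ext fun φ => ?_⟩, 0, fun h => he (congrArg Subtype.val h)⟩
  rw [Nakayama.functional_map, hφ, LinearMap.comp_apply, apply_p1_gen h₀, map_mul,
    character_xi_of_ne _ (StepIndex.weight_l_ne h₀), zero_mul]
  rfl

/-- Every morphism to `K_λ` that is not a split epimorphism lifts to the middle term. -/
theorem exists_lift_middleSnd (h₀ : ∀ x, x = x₀) {X : Type*} [AddCommGroup X]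
    [Module (Alg K n r) X] (h : X →ₗ[Alg K n r] Simple K lam)
    (hns : ¬ ∃ s : Simple K lam →ₗ[Alg K n r] X, h ∘ₗ s = LinearMap.id) :
    ∃ h' : X →ₗ[Alg K n r] middle K lam, middleSnd K lam ∘ₗ h' = h := by
  let _ : Module K X := Module.compHom X (algebraMap K (Alg K n r))
  have hsmul : ∀ (c : K) (x : X), c • x = algebraMap K (Alg K n r) c • x := fun _ _ => rfl
  set ξ : Alg K n r := xi K (x₀.weight K).l lam.l x₀.weight_l_le with hξ
  let u : X →ₗ[K] X :=
    { toFun := fun x => ξ • x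
      map_add' := fun x y => smul_add _ _ _
      map_smul' := fun c x => by
        simp only [hsmul, smul_smul, RingHom.id_apply]
        rw [Algebra.commutes] }
  let g : X →ₗ[K] K :=
    { toFun := fun x => (h x).val
      map_add' := fun x y => by rw [map_add, map_add]
      map_smul' := fun c x => by
        rw [hsmul, map_smul, Simple.val_smul, character_algebraMap]
        rfl }
  have hker : LinearMap.ker u ≤ LinearMap.ker g := by
    intro x hx
    have hx' : ξ • x = 0 := hx
    change (h x).val = 0
    by_contra hne
    -- Since ξx = 0, the description of S ξ_λ modulo Sξ makes S act on ξ_λ x through the character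
    -- at λ. This vector then yields a section of h.
    have hact : ∀ a : Alg K n r,
        a • xiIdem K lam • x = algebraMap K (Alg K n r) (character K lam a) • xiIdem K lam • x := by
      intro a
      obtain ⟨b, hb⟩ := exists_mul_xiIdem_eq h₀ a
      rw [smul_smul, hb, add_smul, mul_smul, hx', smul_zero, add_zero, smul_smul,
        ← Algebra.smul_def]
    refine hns ⟨{ toFun := fun c =>
        algebraMap K (Alg K n r) (c.val * ((h x).val)⁻¹) • xiIdem K lam • x
                  map_add' := ?_
                  map_smul' := ?_ }, ?_⟩
    · intro c d
      rw [map_add, add_mul, map_add, add_smul]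
    · intro a c
      rw [RingHom.id_apply, Simple.val_smul, smul_smul a, ← Algebra.commutes, mul_smul _ a, hact a,
        smul_smul (algebraMap K (Alg K n r) (c.val * ((h x).val)⁻¹)), ← map_mul]
      congr 2
      ring
    · refine LinearMap.ext fun c => Simple.val_injective ?_
      change (h (algebraMap K (Alg K n r) (c.val * ((h x).val)⁻¹) • xiIdem K lam • x)).val =
        c.val
      rw [h.map_smul, h.map_smul, Simple.val_smul, Simple.val_smul, character_algebraMap,
        character_xiIdem, one_mul, inv_mul_cancel_right₀ hne]
  obtain ⟨f, hf⟩ := LinearMap.exists_comp_eq_of_ker_le u g hker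
  have hf' : ∀ x, f (ξ • x) = (h x).val := fun x => LinearMap.congr_fun hf x
  -- As φ(p₁(gen)) = ξ φ(gen), the relation f(ξx) = h(x) is exactly the membership condition for the
  -- middle term.
  let z : X →ₗ[Alg K n r] Nakayama K (Alg K n r) (P1 K lam) :=
    { toFun := fun x => Nakayama.ofFunctional
        { toFun := fun φ => f (φ (P1.gen lam) • x)
          map_add' := fun φ ψ => by rw [LinearMap.add_apply, add_smul, map_add]
          map_smul' := fun c φ => by
            rw [LinearMap.smul_apply, Algebra.smul_def, mul_smul, ← hsmul, map_smul]
            rfl }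
      map_add' := fun x y => Nakayama.ext fun φ => by
        change f (φ (P1.gen lam) • (x + y)) = f (φ (P1.gen lam) • x) + f (φ (P1.gen lam) • y)
        rw [smul_add, map_add]
      map_smul' := fun a x => Nakayama.ext fun φ => by
        change f (φ (P1.gen lam) • a • x) = f ((φ (P1.gen lam) * a) • x)
        rw [smul_smul] }
  refine ⟨LinearMap.codRestrict (middle K lam) (z.prod h) fun x => ?_, rfl⟩
  refine (mem_middle_iff _ _).mpr fun φ => ?_
  change f (φ (p1 K lam (P1.gen lam)) • x) = _
  rw [apply_p1_gen h₀, mul_smul, hf', map_smul, Simple.val_smul]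

theorem isAuslanderReiten_middle (h₀ : ∀ x, x = x₀) :
    IsAuslanderReiten (middleInl K lam) (middleSnd K lam) where
  finite_left := inferInstance
  finite_middle := Module.Finite.of_injective _ middleFst_injective
  finite_right := inferInstance
  injective := middleInl_injective
  exact := exact_middleInl_middleSnd
  surjective := middleSnd_surjective h₀
  not_split := not_split_middleSnd h₀
  indecomposable_left :=
    have := nontrivial_tau h₀
    ((hasSocleElement_nakayama_P1 h₀).of_injective (tau K lam).subtype
      (Submodule.injective_subtype _)).isIndecomposable
  indecomposable_right := (Simple.hasSocleElement lam).isIndecomposable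
  factors _ _ _ _ hX h hh := exists_lift_middleSnd h₀ h fun ⟨_, hs⟩ =>
    hh (hX.bijective_of_comp_eq_id hs)

theorem hasSocleElement_middle (h₀ : ∀ x, x = x₀) :
    HasSocleElement (Alg K n r) (middle K lam) :=
  have := (middleSnd_surjective h₀).nontrivial
  (hasSocleElement_nakayama_P1 h₀).of_injective _ middleFst_injective

end Sequence

end BorelSchur

theorem mainTheorem8 {K : Type u} [Field K] [Infinite K] :
    (∀ (n r : ℕ) (lam : Weight n r),
      IsIndecomposable (Alg K n r) (P1 K lam) →
        IsAuslanderReiten (middleInl K lam) (middleSnd K lam) ∧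
        IsSimpleModule (Alg K n r) (moduleSocle (Alg K n r) (middle K lam)) ∧
        IsIndecomposable (Alg K n r) (middle K lam)) ∧
    (ringChar K = 0 → ∀ (r : ℕ) (lam : Weight 2 r), lam.1 1 ≠ 0 →
      IsAuslanderReiten (middleInl K lam) (middleSnd K lam) ∧
      IsIndecomposable (Alg K 2 r) (middle K lam)) := by
  refine ⟨fun n r lam h => ?_, fun hK r lam hlam => ?_⟩
  · obtain ⟨x₀, h₀⟩ := exists_forall_eq_of_isIndecomposable_P1 h
    exact ⟨isAuslanderReiten_middle h₀, (hasSocleElement_middle h₀).isSimpleModule_socle,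
      (hasSocleElement_middle h₀).isIndecomposable⟩
  · obtain ⟨x₀, h₀⟩ := StepIndex.exists_forall_eq_of_ringChar_eq_zero hK hlam
    exact ⟨isAuslanderReiten_middle h₀, (hasSocleElement_middle h₀).isIndecomposable⟩
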